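/- Let $M$ be a smooth manifold (without boundary) of dimension $2n$ with an almost skew-Hermitian structure $(J,g,\tilde g)$: $J$ is a smooth almost complex structure, $g$ is a smooth pseudo-Riemannian metric with $g(JX,JY)=-g(X,Y)$ (so $g$ has signature $(n,n)$), and $\tilde g=g(\cdot,J\cdot)$ is the associated metric. Let $\nabla$ be the Levi-Civita connection of $g$ and let $X^H, X^V$ denote the horizontal lift (with respect to $\nabla$) and the vertical lift of a vector $X$ to $TM$: in induced coordinates $(x^i,y^i)$ on $TM$, $X^V$ has components $(0,X^k)$ and $X^H$ has components $(X^k,-\Gamma^k_{ij}y^iX^j)$. Equip $TM$ with the Sasaki metric $\hat g$, $$\hat g(X^H,Y^H)=\hat g(X^V,Y^V)=g(X,Y),\qquad \hat g(X^H,Y^V)=0,$$ and with $H=(J_1,J_2,J_3)$, $$J_1:\ X^H\mapsto X^V,\ X^V\mapsto -X^H;\qquad J_2:\ X^H\mapsto (JX)^V,\ X^V\mapsto (JX)^H;\qquad J_3=J_1\circ J_2 .$$ Terminology. A manifold is flat if the curvature tensor of the Levi-Civita connection of its metric vanishes. For an almost complex structure $J$ and a pseudo-Riemannian metric $g$ put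 $F(X,Y,Z)=g((\nabla_XJ)Y,Z)$, $\nabla$ being the Levi-Civita connection of $g$. The pair $(J,g)$ is Kähler if $g(JX,JY)=g(X,Y)$ and $F=0$ (indefinite $g$ is allowed), and skew-Kähler if $g(JX,JY)=-g(X,Y)$ and $\nabla J=0$. A manifold with a pseudo-Riemannian metric $g$ and three pairwise anticommuting almost complex structures $J_1$, $J_2$, $J_3=J_1\circ J_2$ satisfying $g(X,Y)=g(J_1X,J_1Y)=-g(J_2X,J_2Y)=-g(J_3X,J_3Y)$ is an almost hypercomplex pseudo-Hermitian manifold (with the derived forms $\Phi=g(J_1\cdot,\cdot)$, $g_2=g(J_2\cdot,\cdot)$, $g_3=g(J_3\cdot,\cdot)$); it is pseudo-hyper-Kähler if $F_\alpha(X,Y,Z)=g((\nabla_XJ_\alpha)Y,Z)$ vanishes for $\alpha=1,2,3$. Then: (i) $(TM,J_1,\hat g)$ is Kähler if and only if $M$ is flat; (ii) for each $\beta\in\{2,3\}$, $(TM,J_\beta,\hat g)$ is skew-Kähler if and only if $(M,J,g,\tilde g)$ is flat and skew-Kähler; (iii) $(TM,H,\hat g)$ with its derived forms is pseudo-hyper-Kähler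 if and only if $(M,J,g,\tilde g)$ is flat and skew-Kähler. -/

import Mathlib

open Bundle Set
open scoped Manifold ContDiff

set_option maxSynthPendingDepth 3

noncomputable section

namespace SasakiTangent

/-! ### Metrics and connections in an open piece of a vector space

`G : E → E →L[ℝ] E →L[ℝ] ℝ` is the coordinate expression of a (pseudo-Riemannian) metric. -/

section Local

variable {E : Type*} [NormedAddCommGroup E] [NormedSpace ℝ E]

/-- The Christoffel symbols of the first kind, as a covector-valued bilinear map:
`v, w, z ↦ (1/2) (∂_v G(w, z) + ∂_w G(v, z) - ∂_z G(v, w))`. -/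
def christoffelFirst (G : E → E →L[ℝ] E →L[ℝ] ℝ) (y : E) : E →L[ℝ] E →L[ℝ] E →L[ℝ] ℝ :=
  let D : E →L[ℝ] E →L[ℝ] E →L[ℝ] ℝ := fderiv ℝ G y
  let T : (E →L[ℝ] E →L[ℝ] ℝ) →L[ℝ] E →L[ℝ] E →L[ℝ] ℝ :=
    ContinuousLinearMap.flipₗᵢ ℝ E E ℝ
  let D' : E →L[ℝ] E →L[ℝ] E →L[ℝ] ℝ := T ∘L D.flip
  (1 / 2 : ℝ) • (D + D.flip - D')

theorem christoffelFirst_apply (G : E → E →L[ℝ] E →L[ℝ] ℝ) (y v w z : E) :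
    christoffelFirst G y v w z =
      1 / 2 * (fderiv ℝ G y v w z + fderiv ℝ G y w v z - fderiv ℝ G y z v w) := by
  simp [christoffelFirst]

/-- The Christoffel symbols of the Levi-Civita connection of `G`: the vector `Γ(v, w)` with
`G(Γ(v, w), z) = (1/2) (∂_v G(w, z) + ∂_w G(v, z) - ∂_z G(v, w))` for all `z`, obtained by
applying to that covector the inverse of `G y : E → E*`. -/
def christoffel (G : E → E →L[ℝ] E →L[ℝ] ℝ) (y : E) : E →L[ℝ] E →L[ℝ] E :=
  (ContinuousLinearMap.compL ℝ E (E →L[ℝ] ℝ) E (ContinuousLinearMap.inverse (G y))) ∘L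
    christoffelFirst G y

theorem christoffel_apply (G : E → E →L[ℝ] E →L[ℝ] ℝ) (y v w : E) :
    christoffel G y v w = ContinuousLinearMap.inverse (G y) (christoffelFirst G y v w) := rfl

/-- The curvature `R(v, w) z` of the connection with Christoffel symbols `Γ`, for the convention
`R(X, Y) = [∇_X, ∇_Y] - ∇_[X, Y]`. -/
def localCurvature (Γ : E → E →L[ℝ] E →L[ℝ] E) (y v w z : E) : E :=
  fderiv ℝ Γ y v w z - fderiv ℝ Γ y w v z + Γ y v (Γ y w z) - Γ y w (Γ y v z)

/-- The covariant derivative `(∇_v A) w` of a field of endomorphisms `A` with respect to the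
connection with Christoffel symbols `Γ`. -/
def localNablaEnd (Γ : E → E →L[ℝ] E →L[ℝ] E) (A : E → E →L[ℝ] E) (y v w : E) : E :=
  fderiv ℝ A y v w + Γ y v (A y w) - A y (Γ y v w)

end Local

/-! ### Tensor fields on a manifold -/

section Manifold

variable {E : Type*} [NormedAddCommGroup E] [NormedSpace ℝ E]
  {H : Type*} [TopologicalSpace H] (I : ModelWithCorners ℝ E H)
  {M : Type*} [TopologicalSpace M] [ChartedSpace H M]

/-- A field of bilinear forms on the tangent spaces, that is, a `(0, 2)`-tensor field. -/
abbrev BilinField (M : Type*) [TopologicalSpace M] [ChartedSpace H M] :=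
  Π x : M, TangentSpace I x →L[ℝ] TangentSpace I x →L[ℝ] ℝ

/-- A field of endomorphisms of the tangent spaces, that is, a `(1, 1)`-tensor field. -/
abbrev EndField (M : Type*) [TopologicalSpace M] [ChartedSpace H M] :=
  Π x : M, TangentSpace I x →L[ℝ] TangentSpace I x

variable [IsManifold I ∞ M]

/-- A smooth pseudo-Riemannian metric (of arbitrary signature). -/
structure IsPseudoRiemannianMetric (g : BilinField I M) : Prop where
  symm : ∀ (x : M) (v w : TangentSpace I x), g x v w = g x w v
  nondegenerate : ∀ (x : M) (v : TangentSpace I x), (∀ w, g x v w = 0) → v = 0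
  smooth : ContMDiff I (I.prod 𝓘(ℝ, E →L[ℝ] E →L[ℝ] ℝ)) ∞
    (fun x ↦ TotalSpace.mk' (E →L[ℝ] E →L[ℝ] ℝ)
      (E := fun x : M ↦ TangentSpace I x →L[ℝ] TangentSpace I x →L[ℝ] ℝ) x (g x))

/-- A smooth almost complex structure. -/
structure IsAlmostComplex (J : EndField I M) : Prop where
  sq : ∀ (x : M) (v : TangentSpace I x), J x (J x v) = -v
  smooth : ContMDiff I (I.prod 𝓘(ℝ, E →L[ℝ] E)) ∞
    (fun x ↦ TotalSpace.mk' (E →L[ℝ] E)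
      (E := fun x : M ↦ TangentSpace I x →L[ℝ] TangentSpace I x) x (J x))

/-- The coordinate expression of a field of bilinear forms in the preferred chart at `x₀`.
Here `symmL` is the differential of the inverse of the chart. -/
def coordBilin (g : BilinField I M) (x₀ : M) (y : E) : E →L[ℝ] E →L[ℝ] ℝ :=
  let p := (extChartAt I x₀).symm y
  let A : E →L[ℝ] TangentSpace I p := (trivializationAt E (TangentSpace I) x₀).symmL ℝ p
  ContinuousLinearMap.bilinearComp (E := E) (F := E) (g p) A A

/-- The coordinate expression of a field of endomorphisms in the preferred chart at `x₀`. -/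
def coordEnd (J : EndField I M) (x₀ : M) (y : E) : E →L[ℝ] E :=
  let p := (extChartAt I x₀).symm y
  ((trivializationAt E (TangentSpace I) x₀).continuousLinearMapAt ℝ p) ∘L (J p) ∘L
    ((trivializationAt E (TangentSpace I) x₀).symmL ℝ p)

/-- The Christoffel symbols `y ↦ Γ_y` of the Levi-Civita connection of `g` in the preferred chart
at `x₀`. -/
def leviCivitaSymbols (g : BilinField I M) (x₀ : M) : E → E →L[ℝ] E →L[ℝ] E :=
  christoffel (coordBilin I g x₀)

/-! The space `TangentSpace I x` is the model space `E`, a vector being represented by its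
components in the preferred chart at `x`. Tensors at `x` are therefore computed in that chart. -/

/-- The curvature tensor `R(v, w) z` at `x` of the Levi-Civita connection of `g`. -/
def curvature (g : BilinField I M) (x : M) (v w z : TangentSpace I x) : TangentSpace I x :=
  localCurvature (E := E) (leviCivitaSymbols I g x) (extChartAt I x x) v w z

/-- The covariant derivative `(∇_v J) w` at `x`, for the Levi-Civita connection of `g`. -/
def nablaEnd (g : BilinField I M) (J : EndField I M) (x : M) (v w : TangentSpace I x) :
    TangentSpace I x :=
  localNablaEnd (E := E) (leviCivitaSymbols I g x) (coordEnd I J x) (extChartAt I x x) v w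

/-- The structural tensor `F(v, w, z) = g((∇_v J) w, z)`. -/
def structuralTensor (g : BilinField I M) (J : EndField I M) (x : M)
    (v w z : TangentSpace I x) : ℝ :=
  g x (nablaEnd I g J x v w) z

/-- The metric `g` is flat: its curvature tensor vanishes. -/
def IsFlat (g : BilinField I M) : Prop :=
  ∀ (x : M) (v w z : TangentSpace I x), curvature I g x v w z = 0

/-- `(M, J, g)` is an almost (pseudo-)Hermitian manifold: `J` acts by isometries. -/
structure IsAlmostHermitian (J : EndField I M) (g : BilinField I M) : Prop where
  metric : IsPseudoRiemannianMetric I g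
  almostComplex : IsAlmostComplex I J
  compat : ∀ (x : M) (v w : TangentSpace I x), g x (J x v) (J x w) = g x v w

/-- `(M, J, g)` is a (pseudo-)Kähler manifold: almost Hermitian with `F = 0`. -/
structure IsKahler (J : EndField I M) (g : BilinField I M) : Prop
    extends IsAlmostHermitian I J g where
  structural_eq_zero : ∀ (x : M) (v w z : TangentSpace I x), structuralTensor I g J x v w z = 0

/-- `(M, J, g, g̃)` with `g̃ = g(·, J ·)` is an almost skew-Hermitian manifold: `J` acts by
anti-isometries. (Then `g` has neutral signature and `g̃` is a pseudo-Riemannian metric.) -/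
structure IsAlmostSkewHermitian (J : EndField I M) (g : BilinField I M) : Prop where
  metric : IsPseudoRiemannianMetric I g
  almostComplex : IsAlmostComplex I J
  compat : ∀ (x : M) (v w : TangentSpace I x), g x (J x v) (J x w) = -g x v w

/-- `(M, J, g, g̃)` is a skew-Kähler manifold: almost skew-Hermitian with `J` parallel for the
Levi-Civita connection of `g`. -/
structure IsSkewKahler (J : EndField I M) (g : BilinField I M) : Prop
    extends IsAlmostSkewHermitian I J g where
  parallel : ∀ (x : M) (v w : TangentSpace I x), nablaEnd I g J x v w = 0

/-- `(J₁, J₂, J₃; g)` is an almost hypercomplex pseudo-Hermitian structure. The remaining forms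
`Φ = g(J₁ ·, ·)`, `g₂ = g(J₂ ·, ·)`, `g₃ = g(J₃ ·, ·)` are determined by it. -/
structure IsAlmostHypercomplexPseudoHermitian (J₁ J₂ J₃ : EndField I M) (g : BilinField I M) :
    Prop where
  metric : IsPseudoRiemannianMetric I g
  almostComplex₁ : IsAlmostComplex I J₁
  almostComplex₂ : IsAlmostComplex I J₂
  almostComplex₃ : IsAlmostComplex I J₃
  comp : ∀ (x : M) (v : TangentSpace I x), J₃ x v = J₁ x (J₂ x v)
  anticomm₁₂ : ∀ (x : M) (v : TangentSpace I x), J₁ x (J₂ x v) = -J₂ x (J₁ x v)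
  anticomm₂₃ : ∀ (x : M) (v : TangentSpace I x), J₂ x (J₃ x v) = -J₃ x (J₂ x v)
  anticomm₃₁ : ∀ (x : M) (v : TangentSpace I x), J₃ x (J₁ x v) = -J₁ x (J₃ x v)
  compat₁ : ∀ (x : M) (v w : TangentSpace I x), g x (J₁ x v) (J₁ x w) = g x v w
  compat₂ : ∀ (x : M) (v w : TangentSpace I x), g x (J₂ x v) (J₂ x w) = -g x v w
  compat₃ : ∀ (x : M) (v w : TangentSpace I x), g x (J₃ x v) (J₃ x w) = -g x v w

/-- A pseudo-hyper-Kähler manifold: the three structural tensors vanish. -/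
structure IsPseudoHyperKahler (J₁ J₂ J₃ : EndField I M) (g : BilinField I M) : Prop
    extends IsAlmostHypercomplexPseudoHermitian I J₁ J₂ J₃ g where
  structural₁_eq_zero : ∀ (x : M) (v w z : TangentSpace I x), structuralTensor I g J₁ x v w z = 0
  structural₂_eq_zero : ∀ (x : M) (v w z : TangentSpace I x), structuralTensor I g J₂ x v w z = 0
  structural₃_eq_zero : ∀ (x : M) (v w z : TangentSpace I x), structuralTensor I g J₃ x v w z = 0

/-! ### The tangent bundle

The preferred chart of `TangentBundle I M` at `p = (x, u)` is the chart induced by the preferred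
chart of `M` at `x`, so `TangentSpace I.tangent p` is `E × E`, a pair consisting of the components
along `∂/∂xⁱ` and along `∂/∂yⁱ` in the induced coordinates `(xⁱ, yⁱ)`. -/

/-- The differential `T_p(TM) → T_x M` of the bundle projection at `p = (x, u)`. -/
def projDiff (p : TangentBundle I M) : TangentSpace I.tangent p →L[ℝ] TangentSpace I p.proj :=
  ContinuousLinearMap.fst ℝ E E

/-- The vertical lift `X ↦ Xⱽ`, with components `(0, X)`. -/
def vertLift (p : TangentBundle I M) : TangentSpace I p.proj →L[ℝ] TangentSpace I.tangent p :=
  ContinuousLinearMap.inr ℝ E E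

/-- The map `X ↦ Γ(u, X)` on `T_x M`, at the point `p = (x, u)` of the tangent bundle. -/
def symbolAt (g : BilinField I M) (p : TangentBundle I M) :
    TangentSpace I p.proj →L[ℝ] TangentSpace I p.proj :=
  leviCivitaSymbols I g p.proj (extChartAt I p.proj p.proj) p.snd

/-- The horizontal lift `X ↦ Xᴴ` for the Levi-Civita connection, with components
`(X, -Γ(u, X))`. -/
def horLift (g : BilinField I M) (p : TangentBundle I M) :
    TangentSpace I p.proj →L[ℝ] TangentSpace I.tangent p :=
  (ContinuousLinearMap.id ℝ E).prod (-(symbolAt I g p : E →L[ℝ] E))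

/-- The vertical part of a vector `(a, b)` tangent to `TM` at `p = (x, u)`, namely
`b + Γ(u, a)`. -/
def vertPart (g : BilinField I M) (p : TangentBundle I M) :
    TangentSpace I.tangent p →L[ℝ] TangentSpace I p.proj :=
  let Γ : E →L[ℝ] E := symbolAt I g p
  ContinuousLinearMap.snd ℝ E E + Γ ∘L ContinuousLinearMap.fst ℝ E E

variable (g : BilinField I M) (J : EndField I M)

theorem projDiff_horLift (p : TangentBundle I M) (X : TangentSpace I p.proj) :
    projDiff I p (horLift I g p X) = X := rfl

theorem projDiff_vertLift (p : TangentBundle I M) (X : TangentSpace I p.proj) :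
    projDiff I p (vertLift I p X) = 0 := rfl

theorem vertPart_horLift (p : TangentBundle I M) (X : TangentSpace I p.proj) :
    vertPart I g p (horLift I g p X) = 0 :=
  neg_add_cancel (symbolAt I g p X)

theorem vertPart_vertLift (p : TangentBundle I M) (X : TangentSpace I p.proj) :
    vertPart I g p (vertLift I p X) = X := by
  change X + symbolAt I g p 0 = X
  rw [map_zero, add_zero]

/-- Every vector tangent to `TM` is the sum of a horizontal and a vertical lift. -/
theorem eq_horLift_add_vertLift (p : TangentBundle I M) (ξ : TangentSpace I.tangent p) :
    ξ = horLift I g p (projDiff I p ξ) + vertLift I p (vertPart I g p ξ) := by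
  obtain ⟨a, b⟩ := ξ
  refine Prod.ext (add_zero a).symm ?_
  exact (neg_add_cancel_comm_assoc (symbolAt I g p a) b).symm

/-- The Sasaki metric (diagonal lift of `g`). -/
def sasaki : BilinField I.tangent (TangentBundle I M) := fun p ↦
  let B : E →L[ℝ] E →L[ℝ] ℝ := g p.proj
  let P : E × E →L[ℝ] E := projDiff I p
  let K : E × E →L[ℝ] E := vertPart I g p
  B.bilinearComp P P + B.bilinearComp K K

theorem sasaki_apply (p : TangentBundle I M) (ξ η : TangentSpace I.tangent p) :
    sasaki I g p ξ η = g p.proj (projDiff I p ξ) (projDiff I p η) +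
      g p.proj (vertPart I g p ξ) (vertPart I g p η) := rfl

/-- The almost complex structure `J₁ : Xᴴ ↦ Xⱽ, Xⱽ ↦ -Xᴴ`. -/
def J₁ : EndField I.tangent (TangentBundle I M) := fun p ↦
  vertLift I p ∘L projDiff I p - horLift I g p ∘L vertPart I g p

/-- The almost complex structure `J₂ : Xᴴ ↦ (J X)ⱽ, Xⱽ ↦ (J X)ᴴ`. -/
def J₂ : EndField I.tangent (TangentBundle I M) := fun p ↦
  vertLift I p ∘L J p.proj ∘L projDiff I p + horLift I g p ∘L J p.proj ∘L vertPart I g p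

/-- The almost complex structure `J₃ = J₁ ∘ J₂`. -/
def J₃ : EndField I.tangent (TangentBundle I M) := fun p ↦ J₁ I g p ∘L J₂ I g J p

section Lifts

variable (p : TangentBundle I M) (X Y : TangentSpace I p.proj)

theorem sasaki_horLift_horLift :
    sasaki I g p (horLift I g p X) (horLift I g p Y) = g p.proj X Y := by
  simp [sasaki_apply, projDiff_horLift, vertPart_horLift]

theorem sasaki_vertLift_vertLift :
    sasaki I g p (vertLift I p X) (vertLift I p Y) = g p.proj X Y := by
  simp [sasaki_apply, projDiff_vertLift, vertPart_vertLift]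

theorem sasaki_horLift_vertLift :
    sasaki I g p (horLift I g p X) (vertLift I p Y) = 0 := by
  simp [sasaki_apply, projDiff_vertLift, vertPart_horLift]

theorem J₁_horLift : J₁ I g p (horLift I g p X) = vertLift I p X := by
  simp [J₁, projDiff_horLift, vertPart_horLift]

theorem J₁_vertLift : J₁ I g p (vertLift I p X) = -horLift I g p X := by
  simp [J₁, projDiff_vertLift, vertPart_vertLift]

theorem J₂_horLift : J₂ I g J p (horLift I g p X) = vertLift I p (J p.proj X) := by
  simp [J₂, projDiff_horLift, vertPart_horLift]

theorem J₂_vertLift : J₂ I g J p (vertLift I p X) = horLift I g p (J p.proj X) := by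
  simp [J₂, projDiff_vertLift, vertPart_vertLift]

end Lifts

end Manifold

end SasakiTangent

end

/-!
# Kähler-type structures on the tangent bundle with the Sasaki metric

Everything is computed in the frame of `T(TM)` adapted to the splitting into horizontal and vertical
vectors. In an induced chart this frame is the map `Θ (a, b) = (a, b + Γ(u, a))` at `(y, u)`
(`sasakiFrame`). In it the Sasaki metric becomes `G ⊕ G`, and the three almost complex structures
become `(h, k) ↦ (-k, h)`, `(h, k) ↦ (J k, J h)` and `(h, k) ↦ (-J h, J k)`.

The Levi-Civita connection of the Sasaki metric is found by guessing its connection form in this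
frame (`sasakiConnectionForm`): it is `Γ ⊕ Γ` plus terms that are linear in `R(u, ·)` and
`R(·, ·) u`. By the symmetries of the curvature tensor of `g` the guess is torsion-free and
compatible with the metric, so it is the Levi-Civita connection
(`IsMetricOn.sasakiFrame_christoffel`). A field of endomorphisms with matrix `j` in the frame thus
has the covariant derivative `∂j + [Ω, j]`, where `Ω` is the connection form.

If `R = 0`, then `Ω = Γ ⊕ Γ`, and the covariant derivative of the `J_α` is given by the one of `J`
on `M` (and vanishes for `J₁`). Conversely, the derivatives of `J₁` and of `J₂` in a vertical
direction `Xⱽ`, applied to `Yⱽ`, are up to sign and a factor `1/2` the horizontal lifts of `R(u, X)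
Y` and of `R(u, X) J Y`, so that `∇J₁ = 0` and `∇J₂ = 0` both force `R = 0`. For `J₃` this component
vanishes identically; other components give `R(v, w) J = J R(v, w)` and `R(v, J w) = -J R(v, w)`,
and these two relations are compatible with the first Bianchi identity only if `R = 0`
(`IsMetricOn.localCurvature_eq_zero_of_commute`).

The tensors on `TM` are defined pointwise, at each point through the preferred chart there, whereas
derivatives at a point need a whole neighbourhood in one chart. The two descriptions agree since the
adapted frame is independent of the chart (`frameAt_tangentCoordChange`), which is the
transformation law of the Christoffel symbols (`IsMetricOn.fderiv_christoffel_eq`).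
-/

open Filter Topology

namespace SasakiTangent

section LocalGeometry

variable {E F : Type*} [NormedAddCommGroup E] [NormedSpace ℝ E]
  [NormedAddCommGroup F] [NormedSpace ℝ F]

/-! ### Calculus of fields of linear and bilinear maps -/

theorem fderiv_clm_apply_const {E₁ E₂ : Type*} [NormedAddCommGroup E₁] [NormedSpace ℝ E₁]
    [NormedAddCommGroup E₂] [NormedSpace ℝ E₂] {c : F → E₁ →L[ℝ] E₂} {x : F}
    (hc : DifferentiableAt ℝ c x) (ξ : F) (v : E₁) :
    fderiv ℝ (fun x ↦ c x v) x ξ = fderiv ℝ c x ξ v := by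
  rw [fderiv_clm_apply hc (differentiableAt_const v)]
  simp

theorem fderiv_clm_apply_apply {E₁ E₂ : Type*} [NormedAddCommGroup E₁] [NormedSpace ℝ E₁]
    [NormedAddCommGroup E₂] [NormedSpace ℝ E₂] {c : F → E₁ →L[ℝ] E₂} {u : F → E₁} {x : F}
    (hc : DifferentiableAt ℝ c x) (hu : DifferentiableAt ℝ u x) (ξ : F) :
    fderiv ℝ (fun x ↦ c x (u x)) x ξ = fderiv ℝ c x ξ (u x) + c x (fderiv ℝ u x ξ) := by
  rw [fderiv_clm_apply hc hu]
  simp [add_comm]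

theorem fderiv_clm_apply₂ {E₁ E₂ E₃ : Type*} [NormedAddCommGroup E₁] [NormedSpace ℝ E₁]
    [NormedAddCommGroup E₂] [NormedSpace ℝ E₂] [NormedAddCommGroup E₃] [NormedSpace ℝ E₃]
    {c : F → E₁ →L[ℝ] E₂ →L[ℝ] E₃} {u : F → E₁} {w : F → E₂} {x : F}
    (hc : DifferentiableAt ℝ c x) (hu : DifferentiableAt ℝ u x) (hw : DifferentiableAt ℝ w x)
    (ξ : F) :
    fderiv ℝ (fun x ↦ c x (u x) (w x)) x ξ =
      fderiv ℝ c x ξ (u x) (w x) + c x (fderiv ℝ u x ξ) (w x) + c x (u x) (fderiv ℝ w x ξ) := by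
  rw [fderiv_clm_apply_apply (hc.clm_apply hu) hw, fderiv_clm_apply_apply hc hu]
  simp

/-! ### The Levi-Civita connection in an open piece of a vector space -/

/-- `G` is the coordinate expression of a smooth pseudo-Riemannian metric on the open set `U`. -/
structure IsMetricOn (G : E → E →L[ℝ] E →L[ℝ] ℝ) (U : Set E) : Prop where
  isOpen : IsOpen U
  contDiffOn : ContDiffOn ℝ ∞ G U
  symm : ∀ y ∈ U, ∀ v w, G y v w = G y w v
  nondegenerate : ∀ y ∈ U, ∀ v, (∀ w, G y v w = 0) → v = 0

namespace IsMetricOn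

variable {G : E → E →L[ℝ] E →L[ℝ] ℝ} {U : Set E} {y : E}

theorem contDiffAt (hG : IsMetricOn G U) (hy : y ∈ U) : ContDiffAt ℝ ∞ G y :=
  hG.contDiffOn.contDiffAt (hG.isOpen.mem_nhds hy)

theorem differentiableAt (hG : IsMetricOn G U) (hy : y ∈ U) : DifferentiableAt ℝ G y :=
  (hG.contDiffAt hy).differentiableAt (by simp)

theorem eq_of_forall (hG : IsMetricOn G U) (hy : y ∈ U) {v v' : E}
    (h : ∀ w, G y v w = G y v' w) : v = v' :=
  sub_eq_zero.1 <| hG.nondegenerate y hy _ fun w ↦ by simp [h w]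

theorem fderiv_symm (hG : IsMetricOn G U) (hy : y ∈ U) (v w z : E) :
    fderiv ℝ G y v w z = fderiv ℝ G y v z w := by
  have h (w z : E) : fderiv ℝ (fun x ↦ G x w z) y v = fderiv ℝ G y v w z := by
    rw [fderiv_clm_apply₂ (hG.differentiableAt hy) (differentiableAt_const _)
      (differentiableAt_const _)]
    simp
  rw [← h, ← h]
  congr 1
  refine EventuallyEq.fderiv_eq ?_
  filter_upwards [hG.isOpen.mem_nhds hy] with x hx using hG.symm x hx w z

variable [FiniteDimensional ℝ E]

theorem isInvertible (hG : IsMetricOn G U) (hy : y ∈ U) : (G y).IsInvertible := by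
  have hinj : Function.Injective (G y) := by
    intro v v' h
    exact hG.eq_of_forall hy fun w ↦ by rw [h]
  have hdim : Module.finrank ℝ E = Module.finrank ℝ (E →L[ℝ] ℝ) := by
    rw [← (LinearMap.toContinuousLinearMap (𝕜 := ℝ) (E := E) (F' := ℝ)).finrank_eq]
    exact (Subspace.dual_finrank_eq (K := ℝ) (V := E)).symm
  refine ⟨((G y).toLinearMap.linearEquivOfInjective hinj hdim).toContinuousLinearEquiv, ?_⟩
  ext v w
  rfl

theorem apply_christoffel (hG : IsMetricOn G U) (hy : y ∈ U) (v w z : E) :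
    G y (christoffel G y v w) z =
      1 / 2 * (fderiv ℝ G y v w z + fderiv ℝ G y w v z - fderiv ℝ G y z v w) := by
  rw [christoffel_apply, (hG.isInvertible hy).self_apply_inverse, christoffelFirst_apply]

theorem christoffel_symm (hG : IsMetricOn G U) (hy : y ∈ U) (v w : E) :
    christoffel G y v w = christoffel G y w v := by
  refine hG.eq_of_forall hy fun z ↦ ?_
  rw [hG.apply_christoffel hy, hG.apply_christoffel hy, hG.fderiv_symm hy z v w]
  ring

theorem fderiv_eq (hG : IsMetricOn G U) (hy : y ∈ U) (v w z : E) :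
    fderiv ℝ G y v w z = G y (christoffel G y v w) z + G y w (christoffel G y v z) := by
  rw [hG.symm y hy w, hG.apply_christoffel hy, hG.apply_christoffel hy, hG.fderiv_symm hy v z w]
  ring

/-- The fundamental theorem of Riemannian geometry, as a pointwise uniqueness statement: a
torsion-free bilinear operation which is compatible with the first derivative of the metric is the
Levi-Civita connection. -/
theorem christoffel_eq (hG : IsMetricOn G U) (hy : y ∈ U) {B : E → E → E}
    (hsymm : ∀ v w, B v w = B w v)
    (hB : ∀ v w z, fderiv ℝ G y v w z = G y (B v w) z + G y w (B v z)) (v w : E) :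
    christoffel G y v w = B v w := by
  refine hG.eq_of_forall hy fun z ↦ ?_
  rw [hG.apply_christoffel hy, hB, hB, hB, hsymm w v, hsymm z v, hsymm z w, hG.symm y hy (B v z)]
  ring

set_option synthInstance.maxHeartbeats 200000 in
theorem contDiffAt_christoffel (hG : IsMetricOn G U) (hy : y ∈ U) :
    ContDiffAt ℝ ∞ (christoffel G) y := by
  have hD : ContDiffAt ℝ ∞ (fderiv ℝ G) y := (hG.contDiffAt hy).fderiv_right (by simp)
  have hinv : ContDiffAt ℝ ∞ (fun x ↦ ContinuousLinearMap.inverse (G x)) y :=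
    ((hG.isInvertible hy).contDiffAt_map_inverse).comp y (hG.contDiffAt hy)
  have hT : ContDiffAt ℝ ∞ (fun x ↦ (fderiv ℝ G x).flip) y :=
    (ContinuousLinearMap.flipₗᵢ ℝ E E (E →L[ℝ] ℝ)).toContinuousLinearEquiv.contDiff.contDiffAt.comp
      y hD
  have h1 : ContDiffAt ℝ ∞ (christoffelFirst G) y := by
    unfold christoffelFirst
    exact ((hD.add hT).sub (contDiffAt_const.clm_comp hT)).const_smul _
  unfold christoffel
  exact ((ContinuousLinearMap.compL ℝ E (E →L[ℝ] ℝ) E).contDiff.contDiffAt.comp y hinv).clm_comp h1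

theorem differentiableAt_christoffel (hG : IsMetricOn G U) (hy : y ∈ U) :
    DifferentiableAt ℝ (christoffel G) y :=
  (hG.contDiffAt_christoffel hy).differentiableAt (by simp)

theorem fderiv_christoffel_symm (hG : IsMetricOn G U) (hy : y ∈ U) (u v w : E) :
    fderiv ℝ (christoffel G) y u v w = fderiv ℝ (christoffel G) y u w v := by
  have h (v w : E) : fderiv ℝ (fun x ↦ christoffel G x v w) y u =
      fderiv ℝ (christoffel G) y u v w := by
    rw [fderiv_clm_apply₂ (hG.differentiableAt_christoffel hy) (differentiableAt_const _)
      (differentiableAt_const _)]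
    simp
  rw [← h, ← h]
  congr 1
  refine EventuallyEq.fderiv_eq ?_
  filter_upwards [hG.isOpen.mem_nhds hy] with x hx using hG.christoffel_symm hx v w

/-- The transformation law of the Christoffel symbols under a change of coordinates `φ`:
`Dφ(Γ(v, w)) = Γ'(Dφ v, Dφ w) + D²φ(v, w)`. -/
theorem fderiv_christoffel_eq {G' : E → E →L[ℝ] E →L[ℝ] ℝ} {U' : Set E} {φ : E → E}
    (hG : IsMetricOn G U) (hG' : IsMetricOn G' U') (hy : y ∈ U) (hφy : φ y ∈ U')
    (hφ : ContDiffAt ℝ ∞ φ y)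
    (h : ∀ᶠ x in 𝓝 y, ∀ v w, G x v w = G' (φ x) (fderiv ℝ φ x v) (fderiv ℝ φ x w)) (v w : E) :
    fderiv ℝ φ y (christoffel G y v w) =
      christoffel G' (φ y) (fderiv ℝ φ y v) (fderiv ℝ φ y w) +
        fderiv ℝ (fderiv ℝ φ) y v w := by
  have hpt := h.self_of_nhds
  have hinj : Function.Injective (fderiv ℝ φ y) := by
    rw [injective_iff_map_eq_zero]
    intro a ha
    exact hG.nondegenerate y hy a fun w ↦ by rw [hpt, ha]; simp
  have hsurj : Function.Surjective (fderiv ℝ φ y) :=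
    (LinearMap.injective_iff_surjective (f := (fderiv ℝ φ y).toLinearMap)).1 hinj
  have hφ1 : DifferentiableAt ℝ φ y := hφ.differentiableAt (by simp)
  have hφ2 : DifferentiableAt ℝ (fderiv ℝ φ) y :=
    (hφ.fderiv_right (m := ∞) (by simp)).differentiableAt (by simp)
  have hsym (a b : E) : fderiv ℝ (fderiv ℝ φ) y a b = fderiv ℝ (fderiv ℝ φ) y b a :=
    hφ.isSymmSndFDerivAt (by simpa using WithTop.coe_le_coe.2 (le_top : (2 : ℕ∞) ≤ ⊤)) a b
  have hD (a b c : E) : fderiv ℝ G y a b c =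
      fderiv ℝ G' (φ y) (fderiv ℝ φ y a) (fderiv ℝ φ y b) (fderiv ℝ φ y c) +
        G' (φ y) (fderiv ℝ (fderiv ℝ φ) y a b) (fderiv ℝ φ y c) +
        G' (φ y) (fderiv ℝ φ y b) (fderiv ℝ (fderiv ℝ φ) y a c) := by
    have h1 : fderiv ℝ (fun x ↦ G x b c) y a = fderiv ℝ G y a b c := by
      rw [fderiv_clm_apply₂ (hG.differentiableAt hy) (differentiableAt_const _)
        (differentiableAt_const _)]
      simp
    have h2 : (fun x ↦ G x b c) =ᶠ[𝓝 y]
        fun x ↦ G' (φ x) (fderiv ℝ φ x b) (fderiv ℝ φ x c) := by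
      filter_upwards [h] with x hx using hx b c
    have hdG' := hG'.differentiableAt hφy
    rw [← h1, h2.fderiv_eq, fderiv_clm_apply₂ (c := fun x ↦ G' (φ x)) (hdG'.comp y hφ1)
      (hφ2.clm_apply (differentiableAt_const _)) (hφ2.clm_apply (differentiableAt_const _)),
      fderiv_clm_apply_const hφ2, fderiv_clm_apply_const hφ2, fderiv_fun_comp y hdG' hφ1]
    rfl
  refine hG'.eq_of_forall hφy fun z' ↦ ?_
  obtain ⟨z, rfl⟩ := hsurj z'
  rw [← hpt, hG.apply_christoffel hy, map_add, add_apply, hG'.apply_christoffel hφy, hD, hD, hD,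
    hsym w v, hsym z v, hsym z w, hG'.symm _ hφy (fderiv ℝ (fderiv ℝ φ) y v z)]
  ring

end IsMetricOn
end LocalGeometry

section LocalCurvature

variable {E : Type*} [NormedAddCommGroup E] [NormedSpace ℝ E]
  {G : E → E →L[ℝ] E →L[ℝ] ℝ} {U : Set E} {y : E}

/-! ### Symmetries of the curvature tensor -/

theorem localCurvature_antisymm (Γ : E → E →L[ℝ] E →L[ℝ] E) (y v w z : E) :
    localCurvature Γ y w v z = -localCurvature Γ y v w z := by
  simp only [localCurvature]
  abel

namespace IsMetricOn

variable [FiniteDimensional ℝ E]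

theorem localCurvature_bianchi (hG : IsMetricOn G U) (hy : y ∈ U) (v w z : E) :
    localCurvature (christoffel G) y v w z + localCurvature (christoffel G) y w z v +
      localCurvature (christoffel G) y z v w = 0 := by
  simp only [localCurvature]
  rw [hG.christoffel_symm hy w z, hG.christoffel_symm hy v z, hG.christoffel_symm hy v w,
    hG.fderiv_christoffel_symm hy v w z, hG.fderiv_christoffel_symm hy w v z,
    hG.fderiv_christoffel_symm hy z v w]
  abel

/-- The curvature acts by skew-adjoint endomorphisms: this expresses that the second derivatives
of the metric commute, in view of `IsMetricOn.fderiv_eq`. -/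
theorem localCurvature_skew (hG : IsMetricOn G U) (hy : y ∈ U) (v w z t : E) :
    G y (localCurvature (christoffel G) y v w z) t =
      -G y z (localCurvature (christoffel G) y v w t) := by
  have hDG : DifferentiableAt ℝ (fderiv ℝ G) y :=
    ((hG.contDiffAt hy).fderiv_right (m := ∞) (by simp)).differentiableAt (by simp)
  have hΓ := hG.differentiableAt_christoffel hy
  have hsecond (a b : E) : fderiv ℝ (fderiv ℝ G) y a b z t =
      fderiv ℝ G y a (christoffel G y b z) t + G y (fderiv ℝ (christoffel G) y a b z) t +
        (fderiv ℝ G y a z (christoffel G y b t) +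
          G y z (fderiv ℝ (christoffel G) y a b t)) := by
    have h1 : fderiv ℝ (fun x ↦ fderiv ℝ G x b z t) y a = fderiv ℝ (fderiv ℝ G) y a b z t := by
      rw [fderiv_clm_apply₂ (hDG.clm_apply (differentiableAt_const b)) (differentiableAt_const _)
        (differentiableAt_const _), fderiv_clm_apply_const hDG]
      simp
    have h2 : (fun x ↦ fderiv ℝ G x b z t) =ᶠ[𝓝 y]
        fun x ↦ G x (christoffel G x b z) t + G x z (christoffel G x b t) := by
      filter_upwards [hG.isOpen.mem_nhds hy] with x hx using hG.fderiv_eq hx b z t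
    have hΓb (c : E) : DifferentiableAt ℝ (fun x ↦ christoffel G x b c) y :=
      (hΓ.clm_apply (differentiableAt_const b)).clm_apply (differentiableAt_const c)
    have hΓb' (c : E) : fderiv ℝ (fun x ↦ christoffel G x b c) y a =
        fderiv ℝ (christoffel G) y a b c := by
      rw [fderiv_clm_apply₂ hΓ (differentiableAt_const _) (differentiableAt_const _)]
      simp
    have hd := hG.differentiableAt hy
    rw [← h1, h2.fderiv_eq, fderiv_fun_add ((hd.clm_apply (hΓb z)).clm_apply
      (differentiableAt_const t)) ((hd.clm_apply (differentiableAt_const z)).clm_apply (hΓb t)),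
      add_apply, fderiv_clm_apply₂ hd (hΓb z) (differentiableAt_const t),
      fderiv_clm_apply₂ hd (differentiableAt_const z) (hΓb t), hΓb', hΓb']
    simp
  have hcomm : fderiv ℝ (fderiv ℝ G) y v w z t = fderiv ℝ (fderiv ℝ G) y w v z t := by
    rw [(hG.contDiffAt hy).isSymmSndFDerivAt
      (by simpa using WithTop.coe_le_coe.2 (le_top : (2 : ℕ∞) ≤ ⊤)) v w]
  rw [hsecond, hsecond, hG.fderiv_eq hy, hG.fderiv_eq hy, hG.fderiv_eq hy, hG.fderiv_eq hy] at hcomm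
  simp only [localCurvature, map_add, map_sub, add_apply, sub_apply]
  linarith

/-- The pair symmetry `g(R(v, w) z, t) = g(R(z, t) v, w)`. -/
theorem localCurvature_pair (hG : IsMetricOn G U) (hy : y ∈ U) (v w z t : E) :
    G y (localCurvature (christoffel G) y v w z) t =
      G y (localCurvature (christoffel G) y z t v) w := by
  have anti (a b c d : E) : G y (localCurvature (christoffel G) y a b c) d =
      -G y (localCurvature (christoffel G) y b a c) d := by
    rw [localCurvature_antisymm _ _ b a c]; simp
  have skew (a b c d : E) : G y (localCurvature (christoffel G) y a b c) d =
      -G y (localCurvature (christoffel G) y a b d) c := by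
    rw [hG.localCurvature_skew hy, hG.symm y hy]
  have bianchi (a b c d : E) : G y (localCurvature (christoffel G) y a b c) d +
      G y (localCurvature (christoffel G) y b c a) d +
      G y (localCurvature (christoffel G) y c a b) d = 0 := by
    have := congrArg (fun u ↦ G y u d) (hG.localCurvature_bianchi hy a b c)
    simpa using this
  -- The four Bianchi identities of the octahedron argument; the remaining facts identify terms.
  have b1 := bianchi v w z t
  have b2 := bianchi w z t v
  have b3 := bianchi z t v w
  have b4 := bianchi t v w z
  have s1 := skew w z t v
  have s2 := skew z t w v
  have s6 := skew v w t z
  have s7 := skew w t v z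
  have a3 := anti t w z v
  have a4 := anti z v t w
  have s8 := skew z v w t
  have s9 := skew t v w z
  linarith

end IsMetricOn

/-! ### The Sasaki metric in coordinates -/

/-- The frame adapted to the splitting of the tangent spaces of `TM` into horizontal and vertical
vectors: at `q = (y, u)` it sends `(a, b)` to its horizontal and vertical parts
`(a, b + Γ(u, a))`. -/
noncomputable def sasakiFrame (Γ : E → E →L[ℝ] E →L[ℝ] E) (q : E × E) : E × E →L[ℝ] E × E :=
  (ContinuousLinearMap.fst ℝ E E).prod
    (ContinuousLinearMap.snd ℝ E E + Γ q.1 q.2 ∘L ContinuousLinearMap.fst ℝ E E)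

/-- The inverse of `sasakiFrame`: it sends `(h, k)` to the sum of the horizontal lift of `h` and
the vertical lift of `k`. -/
noncomputable def sasakiFrameInv (Γ : E → E →L[ℝ] E →L[ℝ] E) (q : E × E) : E × E →L[ℝ] E × E :=
  (ContinuousLinearMap.fst ℝ E E).prod
    (ContinuousLinearMap.snd ℝ E E - Γ q.1 q.2 ∘L ContinuousLinearMap.fst ℝ E E)

variable {Γ : E → E →L[ℝ] E →L[ℝ] E}

@[simp]
theorem sasakiFrame_apply (q ξ : E × E) :
    sasakiFrame Γ q ξ = (ξ.1, ξ.2 + Γ q.1 q.2 ξ.1) := rfl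

@[simp]
theorem sasakiFrameInv_apply (q ξ : E × E) :
    sasakiFrameInv Γ q ξ = (ξ.1, ξ.2 - Γ q.1 q.2 ξ.1) := rfl

theorem sasakiFrame_sasakiFrameInv (q θ : E × E) : sasakiFrame Γ q (sasakiFrameInv Γ q θ) = θ := by
  simp

theorem sasakiFrameInv_sasakiFrame (q ξ : E × E) : sasakiFrameInv Γ q (sasakiFrame Γ q ξ) = ξ := by
  simp

theorem sasakiFrame_injective (q : E × E) : Function.Injective (sasakiFrame Γ q) :=
  Function.LeftInverse.injective (sasakiFrameInv_sasakiFrame q)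

/-- The coordinate expression of the Sasaki metric of the metric with coordinate expression `G`. -/
noncomputable def localSasaki (G : E → E →L[ℝ] E →L[ℝ] ℝ) (q : E × E) :
    E × E →L[ℝ] E × E →L[ℝ] ℝ :=
  let P : E × E →L[ℝ] E := ContinuousLinearMap.fst ℝ E E
  let K : E × E →L[ℝ] E := ContinuousLinearMap.snd ℝ E E ∘L sasakiFrame (christoffel G) q
  (G q.1).bilinearComp P P + (G q.1).bilinearComp K K

theorem localSasaki_apply (q ξ η : E × E) :
    localSasaki G q ξ η = G q.1 ξ.1 η.1 + G q.1 (ξ.2 + christoffel G q.1 q.2 ξ.1)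
      (η.2 + christoffel G q.1 q.2 η.1) := rfl

/-- The connection form of the Levi-Civita connection of the Sasaki metric in the adapted frame,
in the direction of `ξ = (a, b)` at `(y, u)`: with `κ = b + Γ(u, a)` the vertical part of `ξ`, it
sends `(h, k)` to `(Γ(a, h) + (R(u, k) a + R(u, κ) h) / 2, Γ(a, k) - R(a, h) u / 2)`. -/
noncomputable def sasakiConnectionForm (Γ : E → E →L[ℝ] E →L[ℝ] E) (q ξ θ : E × E) : E × E :=
  (Γ q.1 ξ.1 θ.1 + (1 / 2 : ℝ) • (localCurvature Γ q.1 q.2 θ.2 ξ.1 +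
      localCurvature Γ q.1 q.2 (ξ.2 + Γ q.1 q.2 ξ.1) θ.1),
    Γ q.1 ξ.1 θ.2 - (1 / 2 : ℝ) • localCurvature Γ q.1 ξ.1 θ.1 q.2)

theorem fderiv_symbol_apply {q : E × E} (hΓ : DifferentiableAt ℝ Γ q.1) (ξ : E × E) (a : E) :
    fderiv ℝ (fun q : E × E ↦ Γ q.1 q.2 a) q ξ = fderiv ℝ Γ q.1 ξ.1 q.2 a + Γ q.1 ξ.2 a := by
  have h1 : DifferentiableAt ℝ (fun q : E × E ↦ Γ q.1) q := hΓ.comp q differentiableAt_fst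
  rw [fderiv_clm_apply₂ h1 differentiableAt_snd (differentiableAt_const _),
    fderiv_fun_comp q hΓ differentiableAt_fst]
  simp [fderiv_fst, fderiv_snd]

section FiniteDimensional

variable [FiniteDimensional ℝ E]

theorem contDiffOn_sasakiFrame {n : ℕ∞ω} (hΓ : ContDiffOn ℝ n Γ U) :
    ContDiffOn ℝ n (sasakiFrame Γ) (U ×ˢ univ) := by
  rw [contDiffOn_clm_apply]
  intro ξ
  simp only [sasakiFrame_apply]
  have hΓ' : ContDiffOn ℝ n (fun q : E × E ↦ Γ q.1) (U ×ˢ univ) :=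
    hΓ.comp contDiffOn_fst fun q hq ↦ hq.1
  exact contDiffOn_const.prodMk
    (contDiffOn_const.add ((hΓ'.clm_apply contDiffOn_snd).clm_apply contDiffOn_const))

theorem contDiffOn_sasakiFrameInv {n : ℕ∞ω} (hΓ : ContDiffOn ℝ n Γ U) :
    ContDiffOn ℝ n (sasakiFrameInv Γ) (U ×ˢ univ) := by
  rw [contDiffOn_clm_apply]
  intro ξ
  simp only [sasakiFrameInv_apply]
  have hΓ' : ContDiffOn ℝ n (fun q : E × E ↦ Γ q.1) (U ×ˢ univ) :=
    hΓ.comp contDiffOn_fst fun q hq ↦ hq.1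
  exact contDiffOn_const.prodMk
    (contDiffOn_const.sub ((hΓ'.clm_apply contDiffOn_snd).clm_apply contDiffOn_const))

namespace IsMetricOn

theorem contDiffOn_christoffel (hG : IsMetricOn G U) : ContDiffOn ℝ ∞ (christoffel G) U :=
  fun _ hy ↦ (hG.contDiffAt_christoffel hy).contDiffWithinAt

/-- The Sasaki metric is a pseudo-Riemannian metric. -/
theorem isMetricOn_localSasaki (hG : IsMetricOn G U) : IsMetricOn (localSasaki G) (U ×ˢ univ) where
  isOpen := hG.isOpen.prod isOpen_univ
  contDiffOn := by
    rw [contDiffOn_clm_apply]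
    intro ξ
    rw [contDiffOn_clm_apply]
    intro η
    have hG' : ContDiffOn ℝ ∞ (fun q : E × E ↦ G q.1) (U ×ˢ univ) :=
      hG.contDiffOn.comp contDiffOn_fst fun q hq ↦ hq.1
    have hK (ξ : E × E) : ContDiffOn ℝ ∞
        (fun q : E × E ↦ ξ.2 + christoffel G q.1 q.2 ξ.1) (U ×ˢ univ) :=
      ((contDiffOn_sasakiFrame hG.contDiffOn_christoffel).clm_apply
        (contDiffOn_const (c := ξ))).snd
    simp only [localSasaki_apply]
    exact ((hG'.clm_apply contDiffOn_const).clm_apply contDiffOn_const).add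
      ((hG'.clm_apply (hK ξ)).clm_apply (hK η))
  symm q hq ξ η := by
    rw [localSasaki_apply, localSasaki_apply, hG.symm _ hq.1 ξ.1, hG.symm _ hq.1 (ξ.2 + _)]
  nondegenerate q hq ξ h := by
    apply sasakiFrame_injective (Γ := christoffel G) q
    rw [map_zero]
    refine Prod.ext (hG.nondegenerate _ hq.1 _ fun w ↦ ?_) (hG.nondegenerate _ hq.1 _ fun w ↦ ?_)
    · have := h (sasakiFrameInv (christoffel G) q (w, 0))
      simpa [localSasaki_apply] using this
    · have := h (sasakiFrameInv (christoffel G) q (0, w))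
      simpa [localSasaki_apply] using this

theorem fderiv_sasakiFrame (hG : IsMetricOn G U) {q : E × E} (hq : q.1 ∈ U) (ξ η : E × E) :
    fderiv ℝ (sasakiFrame (christoffel G)) q ξ η =
      (0, fderiv ℝ (christoffel G) q.1 ξ.1 q.2 η.1 + christoffel G q.1 ξ.2 η.1) := by
  have hΘ : DifferentiableAt ℝ (sasakiFrame (christoffel G)) q :=
    ((contDiffOn_sasakiFrame hG.contDiffOn_christoffel).contDiffAt
      ((hG.isOpen.prod isOpen_univ).mem_nhds ⟨hq, mem_univ _⟩)).differentiableAt (by simp)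
  have hΓ := hG.differentiableAt_christoffel hq
  have hs : DifferentiableAt ℝ (fun q : E × E ↦ christoffel G q.1 q.2 η.1) q :=
    ((hΓ.comp q differentiableAt_fst).clm_apply differentiableAt_snd).clm_apply
      (differentiableAt_const _)
  rw [← fderiv_clm_apply_const hΘ]
  simp only [sasakiFrame_apply]
  rw [DifferentiableAt.fderiv_prodMk (differentiableAt_const _) (hs.const_add _)]
  simp [fderiv_const_add, fderiv_symbol_apply hΓ]

theorem fderiv_localSasaki (hG : IsMetricOn G U) {q : E × E} (hq : q.1 ∈ U) (ξ η ζ : E × E) :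
    fderiv ℝ (localSasaki G) q ξ η ζ =
      fderiv ℝ G q.1 ξ.1 η.1 ζ.1 +
      (fderiv ℝ G q.1 ξ.1 (η.2 + christoffel G q.1 q.2 η.1) (ζ.2 + christoffel G q.1 q.2 ζ.1) +
        G q.1 (fderiv ℝ (christoffel G) q.1 ξ.1 q.2 η.1 + christoffel G q.1 ξ.2 η.1)
          (ζ.2 + christoffel G q.1 q.2 ζ.1) +
        G q.1 (η.2 + christoffel G q.1 q.2 η.1)
          (fderiv ℝ (christoffel G) q.1 ξ.1 q.2 ζ.1 + christoffel G q.1 ξ.2 ζ.1)) := by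
  have hd := hG.differentiableAt hq
  have hd' : DifferentiableAt ℝ (fun q : E × E ↦ G q.1) q := hd.comp q differentiableAt_fst
  have hΓ := hG.differentiableAt_christoffel hq
  have hs (a : E) : DifferentiableAt ℝ (fun q : E × E ↦ christoffel G q.1 q.2 a) q :=
    ((hΓ.comp q differentiableAt_fst).clm_apply differentiableAt_snd).clm_apply
      (differentiableAt_const _)
  have hDG : fderiv ℝ (fun q : E × E ↦ G q.1) q ξ = fderiv ℝ G q.1 ξ.1 := by
    rw [fderiv_fun_comp q hd differentiableAt_fst]
    simp [fderiv_fst]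
  have h1 := fderiv_clm_apply₂
    (hG.isMetricOn_localSasaki.differentiableAt (y := q) ⟨hq, mem_univ _⟩)
    (differentiableAt_const η) (differentiableAt_const ζ) ξ
  simp only [fderiv_fun_const, Pi.zero_apply, zero_apply, map_zero, add_zero] at h1
  rw [← h1]
  simp only [localSasaki_apply]
  rw [fderiv_fun_add ((hd'.clm_apply (differentiableAt_const _)).clm_apply
      (differentiableAt_const _)) ((hd'.clm_apply ((hs _).const_add _)).clm_apply
      ((hs _).const_add _)), add_apply,
    fderiv_clm_apply₂ hd' (differentiableAt_const _) (differentiableAt_const _),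
    fderiv_clm_apply₂ hd' ((hs _).const_add _) ((hs _).const_add _), fderiv_const_add,
    fderiv_const_add, fderiv_symbol_apply hΓ, fderiv_symbol_apply hΓ, hDG]
  simp

/-- The Levi-Civita connection of the Sasaki metric, expressed in the adapted frame. -/
theorem sasakiFrame_christoffel (hG : IsMetricOn G U) {q : E × E} (hq : q.1 ∈ U) (ξ η : E × E) :
    sasakiFrame (christoffel G) q (christoffel (localSasaki G) q ξ η) =
      fderiv ℝ (sasakiFrame (christoffel G)) q ξ η +
        sasakiConnectionForm (christoffel G) q ξ (sasakiFrame (christoffel G) q η) := by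
  have hqU : q ∈ U ×ˢ (univ : Set E) := ⟨hq, mem_univ _⟩
  rw [hG.isMetricOn_localSasaki.christoffel_eq hqU (B := fun ξ η ↦ sasakiFrameInv (christoffel G) q
    (fderiv ℝ (sasakiFrame (christoffel G)) q ξ η +
        sasakiConnectionForm (christoffel G) q ξ (sasakiFrame (christoffel G) q η))) _ _ ξ η,
    sasakiFrame_sasakiFrameInv]
  · intro ξ η
    -- Absence of torsion: the symmetry of the vertical component is the definition of `R`.
    congr 1
    rw [hG.fderiv_sasakiFrame hq, hG.fderiv_sasakiFrame hq]
    refine Prod.ext ?_ ?_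
    · simp only [sasakiConnectionForm, sasakiFrame_apply, Prod.fst_add]
      rw [hG.christoffel_symm hq ξ.1 η.1]
      module
    · simp only [sasakiConnectionForm, sasakiFrame_apply, Prod.snd_add, localCurvature, map_add]
      rw [hG.christoffel_symm hq ξ.2 η.1, hG.christoffel_symm hq η.2 ξ.1,
        hG.christoffel_symm hq η.1 q.2, hG.christoffel_symm hq ξ.1 q.2,
        hG.fderiv_christoffel_symm hq ξ.1 η.1 q.2, hG.fderiv_christoffel_symm hq η.1 ξ.1 q.2]
      module
  · intro ξ η ζ
    set k := η.2 + christoffel G q.1 q.2 η.1 with hk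
    set l := ζ.2 + christoffel G q.1 q.2 ζ.1 with hl
    set κ := ξ.2 + christoffel G q.1 q.2 ξ.1 with hκ
    rw [hG.fderiv_localSasaki hq, hG.fderiv_sasakiFrame hq, hG.fderiv_sasakiFrame hq,
      hG.fderiv_eq hq, hG.fderiv_eq hq, localSasaki_apply, localSasaki_apply, ← hk, ← hl]
    simp only [sasakiFrameInv_apply, sasakiFrame_apply, sasakiConnectionForm, Prod.fst_add,
      Prod.snd_add, ← hk, ← hl, ← hκ, map_add, map_sub, map_smul, add_apply,
      sub_apply, smul_apply, smul_eq_mul, zero_add, map_zero, zero_apply]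
    -- The terms in `Γ` and `∂Γ` cancel; the curvature terms are skew-adjoint by the symmetries
    -- of the curvature tensor.
    have s1 := hG.localCurvature_skew hq q.2 κ η.1 ζ.1
    have s2 := hG.localCurvature_pair hq q.2 l ξ.1 η.1
    have s3 := hG.localCurvature_pair hq q.2 k ξ.1 ζ.1
    have t2 := hG.symm q.1 hq η.1 (localCurvature (christoffel G) q.1 q.2 l ξ.1)
    have t3 := hG.symm q.1 hq k (localCurvature (christoffel G) q.1 ξ.1 ζ.1 q.2)
    linarith

end IsMetricOn

/-- The covariant derivative of a field `A` of endomorphisms on `TM` with respect to the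
Sasaki metric, when `A` is given by `j` in the adapted frame. -/
theorem IsMetricOn.sasakiFrame_localNablaEnd (hG : IsMetricOn G U) {q : E × E} (hq : q.1 ∈ U)
    {A j : E × E → E × E →L[ℝ] E × E} (hA : DifferentiableAt ℝ A q) (hj : DifferentiableAt ℝ j q)
    (h : ∀ᶠ r in 𝓝 q, ∀ η, sasakiFrame (christoffel G) r (A r η) =
      j r (sasakiFrame (christoffel G) r η)) (ξ η : E × E) :
    sasakiFrame (christoffel G) q (localNablaEnd (christoffel (localSasaki G)) A q ξ η) =
      fderiv ℝ j q ξ (sasakiFrame (christoffel G) q η) +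
        sasakiConnectionForm (christoffel G) q ξ (j q (sasakiFrame (christoffel G) q η)) -
        j q (sasakiConnectionForm (christoffel G) q ξ (sasakiFrame (christoffel G) q η)) := by
  have hΘ : DifferentiableAt ℝ (sasakiFrame (christoffel G)) q :=
    ((contDiffOn_sasakiFrame hG.contDiffOn_christoffel).contDiffAt
      ((hG.isOpen.prod isOpen_univ).mem_nhds ⟨hq, mem_univ _⟩)).differentiableAt (by simp)
  have hD : fderiv ℝ (sasakiFrame (christoffel G)) q ξ (A q η) +
      sasakiFrame (christoffel G) q (fderiv ℝ A q ξ η) =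
      fderiv ℝ j q ξ (sasakiFrame (christoffel G) q η) +
        j q (fderiv ℝ (sasakiFrame (christoffel G)) q ξ η) := by
    have h' : (fun r ↦ sasakiFrame (christoffel G) r (A r η)) =ᶠ[𝓝 q]
        fun r ↦ j r (sasakiFrame (christoffel G) r η) := h.mono fun r hr ↦ hr η
    have := congrArg (fun L : E × E →L[ℝ] E × E ↦ L ξ) (h'.fderiv_eq (𝕜 := ℝ))
    rwa [fderiv_clm_apply_apply hΘ (hA.clm_apply (differentiableAt_const η)),
      fderiv_clm_apply_apply hj (hΘ.clm_apply (differentiableAt_const η)),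
      fderiv_clm_apply_const hA, fderiv_clm_apply_const hΘ] at this
  have hpt := h.self_of_nhds
  rw [localNablaEnd, map_sub, map_add, hpt, hG.sasakiFrame_christoffel hq,
    hG.sasakiFrame_christoffel hq, hpt, map_add, eq_sub_of_add_eq' hD]
  abel

end FiniteDimensional

end LocalCurvature

section LocalStructures

variable {E : Type*} [NormedAddCommGroup E] [NormedSpace ℝ E]
  {G : E → E →L[ℝ] E →L[ℝ] ℝ} {U : Set E} {y : E}

/-! ### The almost complex structures in coordinates -/

@[simp]
theorem localCurvature_zero_middle (Γ : E → E →L[ℝ] E →L[ℝ] E) (y v z : E) :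
    localCurvature Γ y v 0 z = 0 := by
  simp [localCurvature]

@[simp]
theorem localCurvature_zero_right (Γ : E → E →L[ℝ] E →L[ℝ] E) (y v w : E) :
    localCurvature Γ y v w 0 = 0 := by
  simp [localCurvature]

theorem localCurvature_neg_middle (Γ : E → E →L[ℝ] E →L[ℝ] E) (y v w z : E) :
    localCurvature Γ y v (-w) z = -localCurvature Γ y v w z := by
  simp only [localCurvature, map_neg, neg_apply]
  abel

theorem localCurvature_neg_right (Γ : E → E →L[ℝ] E →L[ℝ] E) (y v w z : E) :
    localCurvature Γ y v w (-z) = -localCurvature Γ y v w z := by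
  simp only [localCurvature, map_neg]
  abel

/-- The structure `J₁` in the adapted frame: `(h, k) ↦ (-k, h)`. -/
noncomputable def frameJ₁ (E : Type*) [NormedAddCommGroup E] [NormedSpace ℝ E] :
    E × E →L[ℝ] E × E :=
  (-ContinuousLinearMap.snd ℝ E E).prod (ContinuousLinearMap.fst ℝ E E)

/-- The structure `J₂` in the adapted frame: `(h, k) ↦ (A k, A h)`. -/
noncomputable def frameJ₂ (A : E →L[ℝ] E) : E × E →L[ℝ] E × E :=
  (A ∘L ContinuousLinearMap.snd ℝ E E).prod (A ∘L ContinuousLinearMap.fst ℝ E E)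

/-- The structure `J₃` in the adapted frame: `(h, k) ↦ (-A h, A k)`. -/
noncomputable def frameJ₃ (A : E →L[ℝ] E) : E × E →L[ℝ] E × E :=
  (-(A ∘L ContinuousLinearMap.fst ℝ E E)).prod (A ∘L ContinuousLinearMap.snd ℝ E E)

@[simp] theorem frameJ₁_apply (θ : E × E) : frameJ₁ E θ = (-θ.2, θ.1) := rfl

@[simp] theorem frameJ₂_apply (A : E →L[ℝ] E) (θ : E × E) : frameJ₂ A θ = (A θ.2, A θ.1) := rfl

@[simp] theorem frameJ₃_apply (A : E →L[ℝ] E) (θ : E × E) : frameJ₃ A θ = (-A θ.1, A θ.2) := rfl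

/-- The field of endomorphisms on `TM` which is given by `j` in the adapted frame. -/
noncomputable def ofFrame (Γ : E → E →L[ℝ] E →L[ℝ] E) (j : E × E → E × E →L[ℝ] E × E)
    (q : E × E) : E × E →L[ℝ] E × E :=
  sasakiFrameInv Γ q ∘L j q ∘L sasakiFrame Γ q

theorem sasakiFrame_ofFrame (Γ : E → E →L[ℝ] E →L[ℝ] E) (j : E × E → E × E →L[ℝ] E × E)
    (q η : E × E) : sasakiFrame Γ q (ofFrame Γ j q η) = j q (sasakiFrame Γ q η) :=
  sasakiFrame_sasakiFrameInv _ _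

theorem sasakiConnectionForm_of_flat {Γ : E → E →L[ℝ] E →L[ℝ] E} {q : E × E}
    (h : ∀ v w z, localCurvature Γ q.1 v w z = 0) (ξ θ : E × E) :
    sasakiConnectionForm Γ q ξ θ = (Γ q.1 ξ.1 θ.1, Γ q.1 ξ.1 θ.2) := by
  simp [sasakiConnectionForm, h]

theorem christoffel_congr {G G' : E → E →L[ℝ] E →L[ℝ] ℝ} (h : G =ᶠ[𝓝 y] G') :
    christoffel G y = christoffel G' y := by
  simp only [christoffel, christoffelFirst, h.fderiv_eq, h.self_of_nhds]

variable {A : E → E →L[ℝ] E}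

theorem fderiv_endomorphism_apply {q : E × E} (hA : DifferentiableAt ℝ A q.1) (ξ : E × E) (v : E) :
    fderiv ℝ (fun q : E × E ↦ A q.1 v) q ξ = fderiv ℝ A q.1 ξ.1 v := by
  have h1 : DifferentiableAt ℝ (fun q : E × E ↦ A q.1) q := hA.comp q differentiableAt_fst
  rw [fderiv_clm_apply_const h1, fderiv_fun_comp q hA differentiableAt_fst]
  simp [fderiv_fst]

variable [FiniteDimensional ℝ E]

theorem contDiffOn_frameJ₂ {n : ℕ∞ω} (hA : ContDiffOn ℝ n A U) :
    ContDiffOn ℝ n (fun q : E × E ↦ frameJ₂ (A q.1)) (U ×ˢ univ) := by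
  have hA' : ContDiffOn ℝ n (fun q : E × E ↦ A q.1) (U ×ˢ univ) :=
    hA.comp contDiffOn_fst fun q hq ↦ hq.1
  rw [contDiffOn_clm_apply]
  intro θ
  simp only [frameJ₂_apply]
  exact (hA'.clm_apply contDiffOn_const).prodMk (hA'.clm_apply contDiffOn_const)

theorem contDiffOn_frameJ₃ {n : ℕ∞ω} (hA : ContDiffOn ℝ n A U) :
    ContDiffOn ℝ n (fun q : E × E ↦ frameJ₃ (A q.1)) (U ×ˢ univ) := by
  have hA' : ContDiffOn ℝ n (fun q : E × E ↦ A q.1) (U ×ˢ univ) :=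
    hA.comp contDiffOn_fst fun q hq ↦ hq.1
  rw [contDiffOn_clm_apply]
  intro θ
  simp only [frameJ₃_apply]
  exact (hA'.clm_apply contDiffOn_const).neg.prodMk (hA'.clm_apply contDiffOn_const)

theorem fderiv_frameJ₂ (hU : IsOpen U) (hA : ContDiffOn ℝ ∞ A U) {q : E × E} (hq : q.1 ∈ U)
    (ξ θ : E × E) : fderiv ℝ (fun q : E × E ↦ frameJ₂ (A q.1)) q ξ θ =
      (fderiv ℝ A q.1 ξ.1 θ.2, fderiv ℝ A q.1 ξ.1 θ.1) := by
  have hd : DifferentiableAt ℝ A q.1 :=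
    (hA.contDiffAt (hU.mem_nhds hq)).differentiableAt (by simp)
  have hd' (v : E) : DifferentiableAt ℝ (fun q : E × E ↦ A q.1 v) q :=
    DifferentiableAt.clm_apply (hd.comp q differentiableAt_fst) (differentiableAt_const v)
  have hj := ((contDiffOn_frameJ₂ hA).contDiffAt
    ((hU.prod isOpen_univ).mem_nhds (x := q) ⟨hq, mem_univ _⟩)).differentiableAt (by simp)
  rw [← fderiv_clm_apply_const hj]
  simp only [frameJ₂_apply]
  rw [DifferentiableAt.fderiv_prodMk (hd' _) (hd' _)]
  simp [fderiv_endomorphism_apply hd]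

theorem fderiv_frameJ₃ (hU : IsOpen U) (hA : ContDiffOn ℝ ∞ A U) {q : E × E} (hq : q.1 ∈ U)
    (ξ θ : E × E) : fderiv ℝ (fun q : E × E ↦ frameJ₃ (A q.1)) q ξ θ =
      (-fderiv ℝ A q.1 ξ.1 θ.1, fderiv ℝ A q.1 ξ.1 θ.2) := by
  have hd : DifferentiableAt ℝ A q.1 :=
    (hA.contDiffAt (hU.mem_nhds hq)).differentiableAt (by simp)
  have hd' (v : E) : DifferentiableAt ℝ (fun q : E × E ↦ A q.1 v) q :=
    DifferentiableAt.clm_apply (hd.comp q differentiableAt_fst) (differentiableAt_const v)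
  have hj := ((contDiffOn_frameJ₃ hA).contDiffAt
    ((hU.prod isOpen_univ).mem_nhds (x := q) ⟨hq, mem_univ _⟩)).differentiableAt (by simp)
  rw [← fderiv_clm_apply_const hj]
  simp only [frameJ₃_apply]
  rw [DifferentiableAt.fderiv_prodMk (hd' _).fun_neg (hd' _)]
  simp [fderiv_endomorphism_apply hd, fderiv_fun_neg]

namespace IsMetricOn

theorem contDiffOn_ofFrame (hG : IsMetricOn G U) {j : E × E → E × E →L[ℝ] E × E}
    (hj : ContDiffOn ℝ ∞ j (U ×ˢ univ)) :
    ContDiffOn ℝ ∞ (ofFrame (christoffel G) j) (U ×ˢ univ) :=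
  (contDiffOn_sasakiFrameInv hG.contDiffOn_christoffel).clm_comp
    (hj.clm_comp (contDiffOn_sasakiFrame hG.contDiffOn_christoffel))

/-- The covariant derivative of a field of endomorphisms on `TM`, in the adapted frame. -/
theorem sasakiFrame_localNablaEnd_ofFrame (hG : IsMetricOn G U) {j : E × E → E × E →L[ℝ] E × E}
    (hj : ContDiffOn ℝ ∞ j (U ×ˢ univ)) {q : E × E} (hq : q.1 ∈ U) (ξ η : E × E) :
    sasakiFrame (christoffel G) q
        (localNablaEnd (christoffel (localSasaki G)) (ofFrame (christoffel G) j) q ξ η) =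
      fderiv ℝ j q ξ (sasakiFrame (christoffel G) q η) +
        sasakiConnectionForm (christoffel G) q ξ (j q (sasakiFrame (christoffel G) q η)) -
        j q (sasakiConnectionForm (christoffel G) q ξ (sasakiFrame (christoffel G) q η)) := by
  have hqU : U ×ˢ univ ∈ 𝓝 q := (hG.isOpen.prod isOpen_univ).mem_nhds ⟨hq, mem_univ _⟩
  exact hG.sasakiFrame_localNablaEnd hq
    (((hG.contDiffOn_ofFrame hj).contDiffAt hqU).differentiableAt (by simp))
    ((hj.contDiffAt hqU).differentiableAt (by simp))
    (Eventually.of_forall fun r η ↦ sasakiFrame_ofFrame _ _ r η) ξ η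

/-- A field of endomorphisms on `TM` is parallel at `q` if and only if it is so in the adapted
frame. -/
theorem localNablaEnd_ofFrame_eq_zero_iff (hG : IsMetricOn G U)
    {j : E × E → E × E →L[ℝ] E × E} (hj : ContDiffOn ℝ ∞ j (U ×ˢ univ)) {q : E × E}
    (hq : q.1 ∈ U) :
    (∀ ξ η, localNablaEnd (christoffel (localSasaki G)) (ofFrame (christoffel G) j) q ξ η = 0) ↔
      ∀ ξ θ, fderiv ℝ j q ξ θ + sasakiConnectionForm (christoffel G) q ξ (j q θ) -
        j q (sasakiConnectionForm (christoffel G) q ξ θ) = 0 := by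
  constructor
  · intro h ξ θ
    have := hG.sasakiFrame_localNablaEnd_ofFrame hj hq ξ (sasakiFrameInv (christoffel G) q θ)
    rwa [h, map_zero, sasakiFrame_sasakiFrameInv, eq_comm] at this
  · intro h ξ η
    apply sasakiFrame_injective (Γ := christoffel G) q
    rw [hG.sasakiFrame_localNablaEnd_ofFrame hj hq, h, map_zero]

/-- `J₁` is parallel along the fibre over `y` if and only if the curvature vanishes at `y`. -/
theorem parallel_J₁_iff (hG : IsMetricOn G U) (hy : y ∈ U) :
    (∀ u ξ η, localNablaEnd (christoffel (localSasaki G))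
      (ofFrame (christoffel G) fun _ ↦ frameJ₁ E) (y, u) ξ η = 0) ↔
    ∀ v w z, localCurvature (christoffel G) y v w z = 0 := by
  refine (forall_congr' fun u ↦ hG.localNablaEnd_ofFrame_eq_zero_iff (q := (y, u))
    (j := fun _ ↦ frameJ₁ E) contDiffOn_const hy).trans ?_
  simp only [fderiv_fun_const, Pi.zero_apply, zero_apply, zero_add]
  constructor
  · intro h v w z
    -- The horizontal part of the derivative of a vertical lift in a vertical direction.
    have := congrArg (Prod.fst : E × E → E) (h v (0, w) (0, -z))
    simpa [sasakiConnectionForm] using this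
  · intro h u ξ θ
    rw [sasakiConnectionForm_of_flat (q := (y, u)) h, sasakiConnectionForm_of_flat (q := (y, u)) h]
    simp

/-- `J₂` is parallel along the fibre over `y` if and only if the curvature and the covariant
derivative of `J` (with coordinate expression `A`) vanish at `y`. -/
theorem parallel_J₂_iff (hG : IsMetricOn G U) (hy : y ∈ U) (hA : ContDiffOn ℝ ∞ A U)
    (hA2 : ∀ v, A y (A y v) = -v) :
    (∀ u ξ η, localNablaEnd (christoffel (localSasaki G))
      (ofFrame (christoffel G) fun q ↦ frameJ₂ (A q.1)) (y, u) ξ η = 0) ↔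
    (∀ v w z, localCurvature (christoffel G) y v w z = 0) ∧
      ∀ v w, localNablaEnd (christoffel G) A y v w = 0 := by
  refine (forall_congr' fun u ↦ hG.localNablaEnd_ofFrame_eq_zero_iff (q := (y, u))
    (j := fun q ↦ frameJ₂ (A q.1)) (contDiffOn_frameJ₂ hA) hy).trans ?_
  have hflat (h : ∀ v w z, localCurvature (christoffel G) y v w z = 0) (u : E) (ξ θ : E × E) :
      fderiv ℝ (fun q : E × E ↦ frameJ₂ (A q.1)) (y, u) ξ θ +
        sasakiConnectionForm (christoffel G) (y, u) ξ (frameJ₂ (A y) θ) -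
        frameJ₂ (A y) (sasakiConnectionForm (christoffel G) (y, u) ξ θ) =
      (localNablaEnd (christoffel G) A y ξ.1 θ.2, localNablaEnd (christoffel G) A y ξ.1 θ.1) := by
    rw [fderiv_frameJ₂ hG.isOpen hA hy, sasakiConnectionForm_of_flat (q := (y, u)) h,
      sasakiConnectionForm_of_flat (q := (y, u)) h]
    rfl
  constructor
  · intro h
    have hR (v w z : E) : localCurvature (christoffel G) y v w z = 0 := by
      -- As for `J₁`; the argument is chosen such that `A y` maps it to `z`.
      have := congrArg (Prod.fst : E × E → E) (h v (0, w) (0, -A y z))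
      rw [fderiv_frameJ₂ hG.isOpen hA hy] at this
      simpa [sasakiConnectionForm, hA2] using this
    refine ⟨hR, fun v w ↦ ?_⟩
    exact congrArg (Prod.snd : E × E → E)
      ((hflat hR 0 (v, 0) (w, 0)).symm.trans (h 0 (v, 0) (w, 0)))
  · rintro ⟨hR, hN⟩ u ξ θ
    rw [hflat hR, hN, hN]
    rfl

/-- The curvature vanishes if `R(v, w)` commutes with `B` and `R(v, B w) = -B R(v, w)`: by these
relations the Bianchi identity for `(B z, v, w)` differs from `B` applied to the one for
`(z, v, w)` only in the sign of the terms other than `B R(v, w) z`. -/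
theorem localCurvature_eq_zero_of_commute (hG : IsMetricOn G U) (hy : y ∈ U) {B : E →L[ℝ] E}
    (hB : ∀ v, B (B v) = -v)
    (h1 : ∀ v w z, localCurvature (christoffel G) y v w (B z) =
      B (localCurvature (christoffel G) y v w z))
    (h2 : ∀ v w z, localCurvature (christoffel G) y v (B w) z =
      -B (localCurvature (christoffel G) y v w z)) (v w z : E) :
    localCurvature (christoffel G) y v w z = 0 := by
  have b1 := hG.localCurvature_bianchi hy (B z) v w
  have b2 := congrArg B (hG.localCurvature_bianchi hy z v w)
  rw [localCurvature_antisymm _ _ v (B z), h1, h2, h2, localCurvature_antisymm _ _ z v,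
    map_neg] at b1
  rw [map_add, map_add, map_zero] at b2
  have h3 : (2 : ℝ) • B (localCurvature (christoffel G) y v w z) = 0 := by
    linear_combination (norm := module) b1 + b2
  have h4 := (smul_eq_zero.1 h3).resolve_left two_ne_zero
  rw [← neg_eq_zero, ← hB, h4, map_zero]

/-- `J₃` is parallel along the fibre over `y` if and only if the curvature and the covariant
derivative of `J` (with coordinate expression `A`) vanish at `y`. -/
theorem parallel_J₃_iff (hG : IsMetricOn G U) (hy : y ∈ U) (hA : ContDiffOn ℝ ∞ A U)
    (hA2 : ∀ v, A y (A y v) = -v) :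
    (∀ u ξ η, localNablaEnd (christoffel (localSasaki G))
      (ofFrame (christoffel G) fun q ↦ frameJ₃ (A q.1)) (y, u) ξ η = 0) ↔
    (∀ v w z, localCurvature (christoffel G) y v w z = 0) ∧
      ∀ v w, localNablaEnd (christoffel G) A y v w = 0 := by
  refine (forall_congr' fun u ↦ hG.localNablaEnd_ofFrame_eq_zero_iff (q := (y, u))
    (j := fun q ↦ frameJ₃ (A q.1)) (contDiffOn_frameJ₃ hA) hy).trans ?_
  have hflat (h : ∀ v w z, localCurvature (christoffel G) y v w z = 0) (u : E) (ξ θ : E × E) :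
      fderiv ℝ (fun q : E × E ↦ frameJ₃ (A q.1)) (y, u) ξ θ +
        sasakiConnectionForm (christoffel G) (y, u) ξ (frameJ₃ (A y) θ) -
        frameJ₃ (A y) (sasakiConnectionForm (christoffel G) (y, u) ξ θ) =
      (-localNablaEnd (christoffel G) A y ξ.1 θ.1, localNablaEnd (christoffel G) A y ξ.1 θ.2) := by
    rw [fderiv_frameJ₃ hG.isOpen hA hy, sasakiConnectionForm_of_flat (q := (y, u)) h,
      sasakiConnectionForm_of_flat (q := (y, u)) h]
    refine Prod.ext ?_ rfl
    simp only [localNablaEnd, frameJ₃_apply, Prod.fst_add, Prod.fst_sub, map_neg]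
    abel
  constructor
  · intro h
    -- The derivative of a horizontal lift: its horizontal part in a vertical direction, and its
    -- vertical part in a horizontal direction.
    have hR := hG.localCurvature_eq_zero_of_commute hy hA2 (fun v w z ↦ by
      have := congrArg (Prod.fst : E × E → E) (h v (0, w) (z, 0))
      rw [fderiv_frameJ₃ hG.isOpen hA hy] at this
      simp only [sasakiConnectionForm, frameJ₃_apply, Prod.fst_add, Prod.fst_sub,
        localCurvature_neg_right] at this
      simp only [map_zero, zero_apply, neg_zero, one_div, localCurvature_zero_right, add_zero,
        zero_add, smul_neg, map_smul, sub_neg_eq_add, Prod.fst_zero] at this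
      exact smul_right_injective E (inv_ne_zero two_ne_zero) (neg_add_eq_zero.1 this))
      (fun v w z ↦ by
      have := congrArg (Prod.snd : E × E → E) (h z (v, 0) (w, 0))
      rw [fderiv_frameJ₃ hG.isOpen hA hy] at this
      simp only [sasakiConnectionForm, frameJ₃_apply, localCurvature_neg_middle] at this
      simp only [map_zero, map_neg, one_div, localCurvature_zero_middle, zero_add, smul_neg,
        sub_neg_eq_add, Prod.mk_add_mk, map_add, map_smul, neg_add_rev, zero_sub, Prod.mk_sub_mk,
        Prod.snd_zero] at this
      rw [← smul_add] at this
      exact eq_neg_of_add_eq_zero_left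
        ((smul_eq_zero.1 this).resolve_left (inv_ne_zero two_ne_zero)))
    refine ⟨hR, fun v w ↦ ?_⟩
    exact congrArg (Prod.snd : E × E → E)
      ((hflat hR 0 (v, 0) (0, w)).symm.trans (h 0 (v, 0) (0, w)))
  · rintro ⟨hR, hN⟩ u ξ θ
    rw [hflat hR, hN, hN, neg_zero]
    rfl

end IsMetricOn

end LocalStructures

section Charts

variable {E : Type*} [NormedAddCommGroup E] [NormedSpace ℝ E]
  {H : Type*} [TopologicalSpace H] (I : ModelWithCorners ℝ E H)
  {M : Type*} [TopologicalSpace M] [ChartedSpace H M] [IsManifold I ∞ M]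

/-! ### Tensor fields in the preferred charts -/

theorem tangentCoordChange_bijective {a p : M} (hp : p ∈ (extChartAt I a).source) :
    Function.Bijective (tangentCoordChange I a p p) := by
  have hpp := mem_extChartAt_source (I := I) p
  refine Function.bijective_iff_has_inverse.2 ⟨tangentCoordChange I p a p, fun v ↦ ?_, fun v ↦ ?_⟩
  · rw [tangentCoordChange_comp ⟨⟨hp, hpp⟩, hp⟩, tangentCoordChange_self hp]
  · rw [tangentCoordChange_comp ⟨⟨hpp, hp⟩, hpp⟩, tangentCoordChange_self hpp]

theorem symm_trivializationAt_eq {a p : M} (hp : p ∈ (extChartAt I a).source) (v : E) :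
    (trivializationAt E (TangentSpace I : M → Type _) a).symm p v =
      tangentCoordChange I a p p v := by
  rw [extChartAt_source] at hp
  rw [← Trivialization.symmL_apply (R := ℝ) _ hp, TangentBundle.symmL_trivializationAt_eq_core hp]
  rfl

variable {I}

/-- The value at `p` of a field of bilinear forms, as a bilinear form on the model space. -/
def bilinAt (g : BilinField I M) (p : M) : E →L[ℝ] E →L[ℝ] ℝ := g p

/-- The value at `p` of a field of endomorphisms, as an endomorphism of the model space. -/
def endAt (J : EndField I M) (p : M) : E →L[ℝ] E := J p

theorem coordBilin_eq (g : BilinField I M) {a p : M} {y : E} (hp : p ∈ (extChartAt I a).source)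
    (hy : (extChartAt I a).symm y = p) (v w : E) :
    coordBilin I g a y v w =
      bilinAt g p (tangentCoordChange I a p p v) (tangentCoordChange I a p p w) := by
  subst hy
  rw [extChartAt_source] at hp
  simp only [coordBilin, TangentBundle.symmL_trivializationAt_eq_core hp]
  rfl

theorem coordEnd_eq (J : EndField I M) {a p : M} {y : E} (hp : p ∈ (extChartAt I a).source)
    (hy : (extChartAt I a).symm y = p) (v : E) :
    coordEnd I J a y v = tangentCoordChange I p a p (endAt J p (tangentCoordChange I a p p v)) := by
  subst hy
  rw [extChartAt_source] at hp
  simp only [coordEnd, TangentBundle.symmL_trivializationAt_eq_core hp,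
    TangentBundle.continuousLinearMapAt_trivializationAt_eq_core hp]
  rfl

theorem tangentCoordChange_coordEnd (J : EndField I M) {a p : M} {y : E}
    (hp : p ∈ (extChartAt I a).source) (hy : (extChartAt I a).symm y = p) (v : E) :
    tangentCoordChange I a p p (coordEnd I J a y v) = endAt J p (tangentCoordChange I a p p v) := by
  have hpp := mem_extChartAt_source (I := I) p
  rw [coordEnd_eq J hp hy, tangentCoordChange_comp ⟨⟨hpp, hp⟩, hpp⟩, tangentCoordChange_self hpp]

theorem coordEnd_sq {J : EndField I M} (hJ : IsAlmostComplex I J) {a : M} {y : E}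
    (hy : y ∈ (extChartAt I a).target) (v : E) :
    coordEnd I J a y (coordEnd I J a y v) = -v := by
  have hp := (extChartAt I a).map_target hy
  apply (tangentCoordChange_bijective I hp).1
  rw [tangentCoordChange_coordEnd J hp rfl, tangentCoordChange_coordEnd J hp rfl, map_neg]
  exact hJ.sq _ _

variable (I)

/-- The constant coordinate vector fields of the chart at `a` are smooth. -/
theorem contMDiffOn_symm_const (a : M) (v : E) :
    ContMDiffOn I I.tangent ∞ (fun p : M ↦ (TotalSpace.mk' E p
      ((trivializationAt E (TangentSpace I) a).symm p v) : TangentBundle I M))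
      (extChartAt I a).source := by
  have h := (trivializationAt E (TangentSpace I : M → Type _) a).contMDiffOn_symm (n := ∞) (IB := I)
  have h2 : ContMDiffOn I (I.prod 𝓘(ℝ, E)) ∞ (fun p : M ↦ (p, v)) (extChartAt I a).source :=
    contMDiffOn_id.prodMk contMDiffOn_const
  rw [extChartAt_source] at h2 ⊢
  refine (h.comp h2 ?_).congr ?_
  · intro p hp
    simpa using hp
  · intro p hp
    exact (Trivialization.mk_symm _ hp v)

theorem contMDiffOn_apply_symm_const {g : BilinField I M} (hg : IsPseudoRiemannianMetric I g)
    (a : M) (v w : E) :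
    ContMDiffOn I 𝓘(ℝ, ℝ) ∞ (fun p ↦ (g p) ((trivializationAt E (TangentSpace I) a).symm p v)
      ((trivializationAt E (TangentSpace I) a).symm p w)) (extChartAt I a).source := by
  intro p hp
  have h := ContMDiffWithinAt.clm_bundle_apply₂ (F₃ := ℝ) (E₃ := Bundle.Trivial M ℝ)
    (hg.smooth.contMDiffAt.contMDiffWithinAt (s := (extChartAt I a).source))
    (contMDiffOn_symm_const I a v p hp) (contMDiffOn_symm_const I a w p hp)
  exact (Bundle.contMDiffWithinAt_totalSpace.1 h).2

section FiniteDimensional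

variable [FiniteDimensional ℝ E]

theorem contDiffOn_coordBilin {g : BilinField I M} (hg : IsPseudoRiemannianMetric I g) (a : M) :
    ContDiffOn ℝ ∞ (coordBilin I g a) (extChartAt I a).target := by
  rw [contDiffOn_clm_apply]
  intro v
  rw [contDiffOn_clm_apply]
  intro w
  rw [← contMDiffOn_iff_contDiffOn]
  refine ((contMDiffOn_apply_symm_const I hg a v w).comp (contMDiffOn_extChartAt_symm a)
    fun y hy ↦ (extChartAt I a).map_target hy).congr fun y hy ↦ ?_
  have hp := (extChartAt I a).map_target hy
  rw [coordBilin_eq g hp rfl, Function.comp_apply, symm_trivializationAt_eq I hp,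
    symm_trivializationAt_eq I hp]
  rfl

theorem contDiffOn_coordEnd {J : EndField I M} (hJ : IsAlmostComplex I J) (a : M) :
    ContDiffOn ℝ ∞ (coordEnd I J a) (extChartAt I a).target := by
  rw [contDiffOn_clm_apply]
  intro v
  have h := ContMDiffOn.clm_bundle_apply (F₂ := E) (E₂ := (TangentSpace I : M → Type _))
    (hJ.smooth.contMDiffOn (s := (extChartAt I a).source)) (contMDiffOn_symm_const I a v)
  have h' := ((trivializationAt E (TangentSpace I : M → Type _) a).contMDiffOn (n := ∞)
    (IB := I)).comp h (fun p hp ↦ by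
      rw [extChartAt_source] at hp
      rw [mem_preimage, Trivialization.mem_source]
      exact hp)
  rw [← contMDiffOn_iff_contDiffOn]
  refine (contMDiff_snd.comp_contMDiffOn (h'.comp (contMDiffOn_extChartAt_symm a)
    fun y hy ↦ (extChartAt I a).map_target hy)).congr fun y hy ↦ ?_
  have hp := (extChartAt I a).map_target hy
  rw [coordEnd_eq J hp rfl, ← symm_trivializationAt_eq I hp]
  rfl

end FiniteDimensional

variable [I.Boundaryless]

/-- A field of bilinear forms is smooth if its coordinate expressions are. -/
theorem contMDiff_of_coordBilin {g : BilinField I M}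
    (h : ∀ a, ContDiffOn ℝ ∞ (coordBilin I g a) (extChartAt I a).target) :
    ContMDiff I (I.prod 𝓘(ℝ, E →L[ℝ] E →L[ℝ] ℝ)) ∞
    (fun x ↦ TotalSpace.mk' (E →L[ℝ] E →L[ℝ] ℝ)
      (E := fun x : M ↦ TangentSpace I x →L[ℝ] TangentSpace I x →L[ℝ] ℝ) x (g x)) := by
  intro a
  rw [contMDiffAt_hom_bundle]
  refine ⟨contMDiffAt_id, ?_⟩
  have h1 : ContMDiffAt I 𝓘(ℝ, E →L[ℝ] E →L[ℝ] ℝ) ∞ (coordBilin I g a ∘ extChartAt I a) a :=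
    ((h a).contDiffAt (extChartAt_target_mem_nhds a)).contMDiffAt.comp a contMDiffAt_extChartAt
  refine h1.congr_of_eventuallyEq ?_
  filter_upwards [extChartAt_source_mem_nhds (I := I) a] with p hp
  ext v w
  have hp' := hp
  rw [extChartAt_source] at hp'
  rw [inCoordinates_apply_eq₂ hp' hp' (mem_univ _), Function.comp_apply,
    coordBilin_eq g hp ((extChartAt I a).left_inv hp)]
  rw [symm_trivializationAt_eq I hp, symm_trivializationAt_eq I hp]
  exact congrArg (fun L : ℝ →ₗ[ℝ] ℝ ↦ L _) (Bundle.Trivial.linearMapAt_trivialization ℝ M ℝ p)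

/-- A field of endomorphisms is smooth if its coordinate expressions are. -/
theorem contMDiff_of_coordEnd {J : EndField I M}
    (h : ∀ a, ContDiffOn ℝ ∞ (coordEnd I J a) (extChartAt I a).target) :
    ContMDiff I (I.prod 𝓘(ℝ, E →L[ℝ] E)) ∞
    (fun x ↦ TotalSpace.mk' (E →L[ℝ] E)
      (E := fun x : M ↦ TangentSpace I x →L[ℝ] TangentSpace I x) x (J x)) := by
  intro a
  rw [contMDiffAt_hom_bundle]
  refine ⟨contMDiffAt_id, ?_⟩
  have h1 : ContMDiffAt I 𝓘(ℝ, E →L[ℝ] E) ∞ (coordEnd I J a ∘ extChartAt I a) a :=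
    ((h a).contDiffAt (extChartAt_target_mem_nhds a)).contMDiffAt.comp a contMDiffAt_extChartAt
  refine h1.congr_of_eventuallyEq ?_
  filter_upwards [extChartAt_source_mem_nhds (I := I) a] with p hp
  ext v
  have hp' := hp
  rw [extChartAt_source] at hp'
  rw [Function.comp_apply, coordEnd_eq J hp ((extChartAt I a).left_inv hp)]
  simp only [ContinuousLinearMap.inCoordinates,
    TangentBundle.symmL_trivializationAt_eq_core hp',
    TangentBundle.continuousLinearMapAt_trivializationAt_eq_core hp']
  rfl

/-! ### Changes of charts -/

/-- The change of coordinates from the preferred chart at `a` to the preferred chart at `b`. -/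
noncomputable def chartChange (a b : M) : E → E := extChartAt I b ∘ (extChartAt I a).symm

theorem contDiffAt_chartChange {a b : M} {y : E} (hy : y ∈ (extChartAt I a).target)
    (hb : (extChartAt I a).symm y ∈ (extChartAt I b).source) :
    ContDiffAt ℝ ∞ (chartChange I a b) y := by
  have h := contDiffWithinAt_ext_coord_change (I := I) (n := ∞) b a (y := y) ⟨hy, hb⟩
  rwa [I.range_eq_univ, contDiffWithinAt_univ] at h

theorem fderiv_chartChange {a b : M} {y : E} (hy : y ∈ (extChartAt I a).target) :
    fderiv ℝ (chartChange I a b) y = tangentCoordChange I a b ((extChartAt I a).symm y) := by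
  rw [tangentCoordChange_def, I.range_eq_univ, fderivWithin_univ, (extChartAt I a).right_inv hy]
  rfl

omit [IsManifold I ∞ M] in
theorem eventually_mem_target {a b : M} {y : E} (hy : y ∈ (extChartAt I a).target)
    (hb : (extChartAt I a).symm y ∈ (extChartAt I b).source) :
    ∀ᶠ x in 𝓝 y, x ∈ (extChartAt I a).target ∧ (extChartAt I a).symm x ∈ (extChartAt I b).source :=
  Filter.Eventually.and ((isOpen_extChartAt_target a).mem_nhds hy)
    (((continuousOn_extChartAt_symm a).continuousAt ((isOpen_extChartAt_target a).mem_nhds hy))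
      ((isOpen_extChartAt_source b).mem_nhds hb))

theorem coordBilin_chartChange (g : BilinField I M) {a b : M} {y : E}
    (hy : y ∈ (extChartAt I a).target)
    (hb : (extChartAt I a).symm y ∈ (extChartAt I b).source) (v w : E) :
    coordBilin I g a y v w = coordBilin I g b (chartChange I a b y)
      (fderiv ℝ (chartChange I a b) y v) (fderiv ℝ (chartChange I a b) y w) := by
  have ha := (extChartAt I a).map_target hy
  have hb' : (extChartAt I b).symm (chartChange I a b y) = (extChartAt I a).symm y :=
    (extChartAt I b).left_inv hb
  rw [coordBilin_eq g ha rfl, coordBilin_eq g hb hb', fderiv_chartChange I hy,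
    tangentCoordChange_comp ⟨⟨ha, hb⟩, mem_extChartAt_source _⟩,
    tangentCoordChange_comp ⟨⟨ha, hb⟩, mem_extChartAt_source _⟩]

variable [FiniteDimensional ℝ E]

theorem isMetricOn_coordBilin {g : BilinField I M} (hg : IsPseudoRiemannianMetric I g) (a : M) :
    IsMetricOn (coordBilin I g a) (extChartAt I a).target where
  isOpen := isOpen_extChartAt_target a
  contDiffOn := contDiffOn_coordBilin I hg a
  symm y hy v w := by
    have hp := (extChartAt I a).map_target hy
    rw [coordBilin_eq g hp rfl, coordBilin_eq g hp rfl]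
    exact hg.symm _ _ _
  nondegenerate y hy v h := by
    have hp := (extChartAt I a).map_target hy
    apply (tangentCoordChange_bijective I hp).1
    rw [map_zero]
    refine hg.nondegenerate ((extChartAt I a).symm y) _ fun w' ↦ ?_
    obtain ⟨w, rfl⟩ := (tangentCoordChange_bijective I hp).2 w'
    exact (coordBilin_eq g hp rfl v w).symm.trans (h w)

/-- The transformation law of the Christoffel symbols of the Levi-Civita connection. -/
theorem leviCivitaSymbols_chartChange {g : BilinField I M} (hg : IsPseudoRiemannianMetric I g)
    {a b : M} {y : E} (hy : y ∈ (extChartAt I a).target)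
    (hb : (extChartAt I a).symm y ∈ (extChartAt I b).source) (v w : E) :
    fderiv ℝ (chartChange I a b) y (leviCivitaSymbols I g a y v w) =
      leviCivitaSymbols I g b (chartChange I a b y) (fderiv ℝ (chartChange I a b) y v)
        (fderiv ℝ (chartChange I a b) y w) +
      fderiv ℝ (fderiv ℝ (chartChange I a b)) y v w :=
  (isMetricOn_coordBilin I hg a).fderiv_christoffel_eq (isMetricOn_coordBilin I hg b) hy
    ((extChartAt I b).map_source hb) (contDiffAt_chartChange I hy hb)
    ((eventually_mem_target I hy hb).mono fun _ hx ↦ coordBilin_chartChange I g hx.1 hx.2) v w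

end Charts

section TangentBundle

variable {E : Type*} [NormedAddCommGroup E] [NormedSpace ℝ E]
  {H : Type*} [TopologicalSpace H] {I : ModelWithCorners ℝ E H}
  {M : Type*} [TopologicalSpace M] [ChartedSpace H M] [IsManifold I ∞ M]

/-! ### The lifted structures in the adapted frame -/

/-- The splitting of the tangent vectors of `TM` at `r` into their horizontal and vertical parts,
in the preferred chart at `r`. -/
noncomputable def frameAt (g : BilinField I M) (r : TangentBundle I M) : E × E →L[ℝ] E × E :=
  sasakiFrame (leviCivitaSymbols I g r.proj) (extChartAt I r.proj r.proj, r.snd)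

theorem bilinAt_sasaki (g : BilinField I M) (r : TangentBundle I M) (ξ η : E × E) :
    bilinAt (sasaki I g) r ξ η = bilinAt g r.proj (frameAt g r ξ).1 (frameAt g r η).1 +
      bilinAt g r.proj (frameAt g r ξ).2 (frameAt g r η).2 := rfl

theorem eq_of_projDiff_eq_of_vertPart_eq {g : BilinField I M} {r : TangentBundle I M}
    {ξ η : TangentSpace I.tangent r} (h : projDiff I r ξ = projDiff I r η)
    (h' : vertPart I g r ξ = vertPart I g r η) : ξ = η := by
  rw [eq_horLift_add_vertLift I g r ξ, h, h', ← eq_horLift_add_vertLift]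

section Parts

variable (g : BilinField I M) (J : EndField I M) (r : TangentBundle I M)
  (ξ : TangentSpace I.tangent r)

theorem projDiff_J₁ : projDiff I r (J₁ I g r ξ) = -vertPart I g r ξ := by
  simp [J₁, projDiff_vertLift, projDiff_horLift]

theorem vertPart_J₁ : vertPart I g r (J₁ I g r ξ) = projDiff I r ξ := by
  simp [J₁, vertPart_vertLift, vertPart_horLift]

theorem projDiff_J₂ : projDiff I r (J₂ I g J r ξ) = J r.proj (vertPart I g r ξ) := by
  simp [J₂, projDiff_vertLift, projDiff_horLift]

theorem vertPart_J₂ : vertPart I g r (J₂ I g J r ξ) = J r.proj (projDiff I r ξ) := by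
  simp [J₂, vertPart_vertLift, vertPart_horLift]

theorem J₃_apply : J₃ I g J r ξ = J₁ I g r (J₂ I g J r ξ) := rfl

end Parts

theorem frameAt_J₁ (g : BilinField I M) (r : TangentBundle I M) (ξ : E × E) :
    frameAt g r (endAt (J₁ I g) r ξ) = frameJ₁ E (frameAt g r ξ) :=
  Prod.ext (projDiff_J₁ g r ξ) (vertPart_J₁ g r ξ)

theorem frameAt_J₂ (g : BilinField I M) (J : EndField I M) (r : TangentBundle I M) (ξ : E × E) :
    frameAt g r (endAt (J₂ I g J) r ξ) = frameJ₂ (endAt J r.proj) (frameAt g r ξ) :=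
  Prod.ext (projDiff_J₂ g J r ξ) (vertPart_J₂ g J r ξ)

theorem frameAt_J₃ (g : BilinField I M) (J : EndField I M) (r : TangentBundle I M) (ξ : E × E) :
    frameAt g r (endAt (J₃ I g J) r ξ) = frameJ₃ (endAt J r.proj) (frameAt g r ξ) := by
  refine (frameAt_J₁ g r (endAt (J₂ I g J) r ξ)).trans ?_
  rw [frameAt_J₂]
  rfl

/-! ### Induced charts of the tangent bundle -/

theorem extChartAt_tangent_target (p : TangentBundle I M) :
    (extChartAt I.tangent p).target = (extChartAt I p.proj).target ×ˢ univ := by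
  rw [FiberBundle.extChartAt_target]
  congr 1
  refine inter_eq_left.2 fun y hy ↦ ?_
  have := (extChartAt I p.proj).map_target hy
  rwa [extChartAt_source] at this

theorem extChartAt_tangent_self (p : TangentBundle I M) :
    extChartAt I.tangent p p = (extChartAt I p.proj p.proj, p.snd) :=
  Prod.ext rfl (tangentCoordChange_self (mem_extChartAt_source _))

variable [I.Boundaryless]

/-- The change of induced charts of `TM` is `(y, v) ↦ (φ y, Dφ_y v)`. -/
theorem chartChange_tangent (p q : TangentBundle I M) {y v : E}
    (hy : y ∈ (extChartAt I p.proj).target)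
    (hq : (extChartAt I p.proj).symm y ∈ (extChartAt I q.proj).source) :
    chartChange I.tangent p q (y, v) =
      (chartChange I p.proj q.proj y, fderiv ℝ (chartChange I p.proj q.proj) y v) := by
  refine Prod.ext rfl ?_
  rw [fderiv_chartChange I hy]
  exact tangentCoordChange_comp
    ⟨⟨(extChartAt I p.proj).map_target hy, mem_extChartAt_source _⟩, hq⟩

theorem fderiv_chartChange_tangent (p q : TangentBundle I M) {y v : E}
    (hy : y ∈ (extChartAt I p.proj).target)
    (hq : (extChartAt I p.proj).symm y ∈ (extChartAt I q.proj).source) (ξ : E × E) :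
    fderiv ℝ (chartChange I.tangent p q) (y, v) ξ =
      (fderiv ℝ (chartChange I p.proj q.proj) y ξ.1,
        fderiv ℝ (fderiv ℝ (chartChange I p.proj q.proj)) y ξ.1 v +
          fderiv ℝ (chartChange I p.proj q.proj) y ξ.2) := by
  set φ := chartChange I p.proj q.proj
  have hφ : ContDiffAt ℝ ∞ φ y := contDiffAt_chartChange I hy hq
  have hφ1 : DifferentiableAt ℝ φ y := hφ.differentiableAt (by simp)
  have hφ2 : DifferentiableAt ℝ (fderiv ℝ φ) y :=
    (hφ.fderiv_right (m := ∞) (by simp)).differentiableAt (by simp)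
  have hev : chartChange I.tangent p q =ᶠ[𝓝 (y, v)] fun r ↦ (φ r.1, fderiv ℝ φ r.1 r.2) := by
    have := (continuous_fst (X := E) (Y := E)).continuousAt (x := (y, v))
      (eventually_mem_target I hy hq)
    filter_upwards [this] with r hr using chartChange_tangent p q hr.1 hr.2
  have h1 : DifferentiableAt ℝ (fun r : E × E ↦ φ r.1) (y, v) :=
    DifferentiableAt.comp (y, v) (f := Prod.fst) hφ1 differentiableAt_fst
  have h2 : DifferentiableAt ℝ (fun r : E × E ↦ fderiv ℝ φ r.1) (y, v) :=
    DifferentiableAt.comp (y, v) (f := Prod.fst) hφ2 differentiableAt_fst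
  have h3 : DifferentiableAt ℝ (fun r : E × E ↦ fderiv ℝ φ r.1 r.2) (y, v) :=
    h2.clm_apply differentiableAt_snd
  rw [hev.fderiv_eq, DifferentiableAt.fderiv_prodMk h1 h3]
  refine Prod.ext ?_ ?_
  · change fderiv ℝ (fun r : E × E ↦ φ r.1) (y, v) ξ = _
    rw [fderiv_fun_comp (g := φ) (f := Prod.fst) (y, v) hφ1 differentiableAt_fst, fderiv_fst]
    rfl
  · change fderiv ℝ (fun r : E × E ↦ fderiv ℝ φ r.1 r.2) (y, v) ξ = _
    rw [fderiv_clm_apply_apply h2 differentiableAt_snd,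
      fderiv_fun_comp (g := fderiv ℝ φ) (f := Prod.fst) (y, v) hφ2 differentiableAt_fst, fderiv_fst,
      fderiv_snd]
    rfl

/-! ### The Sasaki metric in the induced charts -/

variable [FiniteDimensional ℝ E]

/-- The splitting into horizontal and vertical parts does not depend on the chart. -/
theorem frameAt_tangentCoordChange {g : BilinField I M} (hg : IsPseudoRiemannianMetric I g)
    (p : TangentBundle I M) {q : E × E} (hq : q.1 ∈ (extChartAt I p.proj).target)
    {r : TangentBundle I M} (hr : (extChartAt I.tangent p).symm q = r) (ξ : E × E) :
    frameAt g r (tangentCoordChange I.tangent p r r ξ) =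
      Prod.map (tangentCoordChange I p.proj r.proj r.proj)
        (tangentCoordChange I p.proj r.proj r.proj)
        (sasakiFrame (leviCivitaSymbols I g p.proj) q ξ) := by
  subst hr
  obtain ⟨y, v⟩ := q
  have hq' : (y, v) ∈ (extChartAt I.tangent p).target := by
    rw [extChartAt_tangent_target]; exact ⟨hq, mem_univ _⟩
  set r := (extChartAt I.tangent p).symm (y, v) with hr
  have hry : r.proj = (extChartAt I p.proj).symm y := rfl
  have hb : (extChartAt I p.proj).symm y ∈ (extChartAt I r.proj).source :=
    mem_extChartAt_source (I := I) r.proj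
  have hφ := contDiffAt_chartChange I hq hb
  have hsnd : r.snd = fderiv ℝ (chartChange I p.proj r.proj) y v := by
    rw [fderiv_chartChange I hq]; rfl
  have hD : tangentCoordChange I p.proj r.proj r.proj = fderiv ℝ (chartChange I p.proj r.proj) y :=
    (fderiv_chartChange I hq).symm
  have hDT : tangentCoordChange I.tangent p r r = fderiv ℝ (chartChange I.tangent p r) (y, v) :=
    (fderiv_chartChange I.tangent hq').symm
  rw [hDT, fderiv_chartChange_tangent p r hq hb, hD, frameAt, sasakiFrame_apply, sasakiFrame_apply,
    hsnd]
  refine Prod.ext rfl ?_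
  change _ + leviCivitaSymbols I g r.proj (chartChange I p.proj r.proj y)
    (fderiv ℝ (chartChange I p.proj r.proj) y v)
    (fderiv ℝ (chartChange I p.proj r.proj) y ξ.1) =
      fderiv ℝ (chartChange I p.proj r.proj) y (ξ.2 + leviCivitaSymbols I g p.proj y v ξ.1)
  rw [map_add, leviCivitaSymbols_chartChange I hg hq hb, hφ.isSymmSndFDerivAt
      (by simpa using WithTop.coe_le_coe.2 (le_top : (2 : ℕ∞) ≤ ⊤)) v ξ.1]
  exact (by intros; abel : ∀ a b c : E, a + b + c = b + (c + a)) _ _ _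

/-- In the induced charts, the Sasaki metric is `localSasaki` of the coordinate expression of `g`,
although it is defined at each point through the preferred chart at that point. -/
theorem coordBilin_sasaki {g : BilinField I M} (hg : IsPseudoRiemannianMetric I g)
    (p : TangentBundle I M) {q : E × E} (hq : q.1 ∈ (extChartAt I p.proj).target) :
    coordBilin I.tangent (sasaki I g) p q = localSasaki (coordBilin I g p.proj) q := by
  have hq' : q ∈ (extChartAt I.tangent p).target := by
    rw [extChartAt_tangent_target]; exact ⟨hq, mem_univ _⟩
  refine ContinuousLinearMap.ext fun ξ ↦ ContinuousLinearMap.ext fun η ↦ ?_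
  set r := (extChartAt I.tangent p).symm q with hr
  have hry : (extChartAt I p.proj).symm q.1 = r.proj := rfl
  have hsrc : r.proj ∈ (extChartAt I p.proj).source := (extChartAt I p.proj).map_target hq
  rw [coordBilin_eq (sasaki I g) ((extChartAt I.tangent p).map_target hq') hr.symm,
    bilinAt_sasaki, frameAt_tangentCoordChange hg p hq hr.symm,
    frameAt_tangentCoordChange hg p hq hr.symm, localSasaki_apply, coordBilin_eq g hsrc hry,
    coordBilin_eq g hsrc hry]
  rfl

/-- If the fields `J'` and `j` of endomorphisms correspond to each other in the adapted frames,
then the coordinate expression of `J'` is given by `j` in the adapted frame. -/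
theorem coordEnd_eq_ofFrame {g : BilinField I M} (hg : IsPseudoRiemannianMetric I g)
    (p : TangentBundle I M) {J' : EndField I.tangent (TangentBundle I M)}
    {j : E × E → E × E →L[ℝ] E × E} {q : E × E} (hq : q.1 ∈ (extChartAt I p.proj).target)
    {r : TangentBundle I M} (hr : (extChartAt I.tangent p).symm q = r)
    {j' : E × E →L[ℝ] E × E} (hj' : ∀ ξ, frameAt g r (endAt J' r ξ) = j' (frameAt g r ξ))
    (hj : ∀ θ, j' (Prod.map (tangentCoordChange I p.proj r.proj r.proj)
        (tangentCoordChange I p.proj r.proj r.proj) θ) =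
      Prod.map (tangentCoordChange I p.proj r.proj r.proj)
        (tangentCoordChange I p.proj r.proj r.proj) (j q θ)) :
    coordEnd I.tangent J' p q = ofFrame (leviCivitaSymbols I g p.proj) j q := by
  have hq' : q ∈ (extChartAt I.tangent p).target := by
    rw [extChartAt_tangent_target]; exact ⟨hq, mem_univ _⟩
  have hsrc : r ∈ (extChartAt I.tangent p).source := by
    rw [← hr]; exact (extChartAt I.tangent p).map_target hq'
  refine ContinuousLinearMap.ext fun ξ ↦ ?_
  apply (tangentCoordChange_bijective I.tangent hsrc).1
  apply sasakiFrame_injective (Γ := leviCivitaSymbols I g r.proj)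
    (extChartAt I r.proj r.proj, r.snd)
  change frameAt g r _ = frameAt g r _
  rw [tangentCoordChange_coordEnd J' hsrc hr, hj', frameAt_tangentCoordChange hg p hq hr,
    frameAt_tangentCoordChange hg p hq hr, sasakiFrame_ofFrame, hj]

theorem coordEnd_J₁ {g : BilinField I M} (hg : IsPseudoRiemannianMetric I g)
    (p : TangentBundle I M) {q : E × E} (hq : q.1 ∈ (extChartAt I p.proj).target) :
    coordEnd I.tangent (J₁ I g) p q =
      ofFrame (leviCivitaSymbols I g p.proj) (fun _ ↦ frameJ₁ E) q :=
  coordEnd_eq_ofFrame hg p hq rfl (frameAt_J₁ g _) fun θ ↦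
    Prod.ext (map_neg (tangentCoordChange I p.proj _ _) θ.2).symm rfl

theorem coordEnd_J₂ {g : BilinField I M} (hg : IsPseudoRiemannianMetric I g) (J : EndField I M)
    (p : TangentBundle I M) {q : E × E} (hq : q.1 ∈ (extChartAt I p.proj).target) :
    coordEnd I.tangent (J₂ I g J) p q =
      ofFrame (leviCivitaSymbols I g p.proj) (fun q ↦ frameJ₂ (coordEnd I J p.proj q.1)) q :=
  coordEnd_eq_ofFrame hg p hq rfl (frameAt_J₂ g J _) fun _ ↦
    Prod.ext (tangentCoordChange_coordEnd J ((extChartAt I p.proj).map_target hq) rfl _).symm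
      (tangentCoordChange_coordEnd J ((extChartAt I p.proj).map_target hq) rfl _).symm

theorem coordEnd_J₃ {g : BilinField I M} (hg : IsPseudoRiemannianMetric I g) (J : EndField I M)
    (p : TangentBundle I M) {q : E × E} (hq : q.1 ∈ (extChartAt I p.proj).target) :
    coordEnd I.tangent (J₃ I g J) p q =
      ofFrame (leviCivitaSymbols I g p.proj) (fun q ↦ frameJ₃ (coordEnd I J p.proj q.1)) q :=
  coordEnd_eq_ofFrame hg p hq rfl (frameAt_J₃ g J _) fun _ ↦
    Prod.ext ((map_neg (tangentCoordChange I p.proj _ _) _).trans (congrArg Neg.neg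
      (tangentCoordChange_coordEnd J ((extChartAt I p.proj).map_target hq) rfl _))).symm
      (tangentCoordChange_coordEnd J ((extChartAt I p.proj).map_target hq) rfl _).symm

end TangentBundle

section Main

variable {E : Type*} [NormedAddCommGroup E] [NormedSpace ℝ E]
  {H : Type*} [TopologicalSpace H] {I : ModelWithCorners ℝ E H}
  {M : Type*} [TopologicalSpace M] [ChartedSpace H M] [IsManifold I ∞ M]

/-! ### Pointwise identities for the lifted structures -/

section Pointwise

variable (g : BilinField I M) (J : EndField I M) (r : TangentBundle I M)
  (ξ η : TangentSpace I.tangent r)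

theorem J₁_J₁ : J₁ I g r (J₁ I g r ξ) = -ξ := by
  apply eq_of_projDiff_eq_of_vertPart_eq (g := g)
  · rw [projDiff_J₁, vertPart_J₁, map_neg]
  · rw [vertPart_J₁, projDiff_J₁, map_neg]

theorem J₁_J₂ : J₁ I g r (J₂ I g J r ξ) = -J₂ I g J r (J₁ I g r ξ) := by
  apply eq_of_projDiff_eq_of_vertPart_eq (g := g)
  · rw [projDiff_J₁, vertPart_J₂, map_neg, projDiff_J₂, vertPart_J₁]
  · rw [vertPart_J₁, projDiff_J₂, map_neg, vertPart_J₂, projDiff_J₁, map_neg, neg_neg]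

theorem J₂_J₁ : J₂ I g J r (J₁ I g r ξ) = -J₁ I g r (J₂ I g J r ξ) := by
  rw [J₁_J₂, neg_neg]

theorem sasaki_J₁ : sasaki I g r (J₁ I g r ξ) (J₁ I g r η) = sasaki I g r ξ η := by
  simp only [sasaki_apply, projDiff_J₁, vertPart_J₁, map_neg, neg_apply, neg_neg]
  exact add_comm _ _

variable {J}

theorem J₂_J₂ (hJ : ∀ x v, J x (J x v) = -v) : J₂ I g J r (J₂ I g J r ξ) = -ξ := by
  apply eq_of_projDiff_eq_of_vertPart_eq (g := g)
  · rw [projDiff_J₂, vertPart_J₂, hJ, map_neg]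
  · rw [vertPart_J₂, projDiff_J₂, hJ, map_neg]

theorem J₃_J₃ (hJ : ∀ x v, J x (J x v) = -v) : J₃ I g J r (J₃ I g J r ξ) = -ξ := by
  rw [J₃_apply, J₃_apply, J₂_J₁, map_neg, J₁_J₁, neg_neg, J₂_J₂ g r ξ hJ]

theorem sasaki_J₂ (h : ∀ x v w, g x (J x v) (J x w) = -g x v w) :
    sasaki I g r (J₂ I g J r ξ) (J₂ I g J r η) = -sasaki I g r ξ η := by
  rw [sasaki_apply, sasaki_apply, projDiff_J₂, projDiff_J₂, vertPart_J₂, vertPart_J₂, h, h, neg_add,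
    add_comm]

theorem sasaki_J₃ (h : ∀ x v w, g x (J x v) (J x w) = -g x v w) :
    sasaki I g r (J₃ I g J r ξ) (J₃ I g J r η) = -sasaki I g r ξ η := by
  rw [J₃_apply, J₃_apply, sasaki_J₁, sasaki_J₂ g r ξ η h]

end Pointwise

theorem structuralTensor_eq_zero_iff {g : BilinField I M}
    (hg : IsPseudoRiemannianMetric I g) (J : EndField I M) :
    (∀ x (v w z : TangentSpace I x), structuralTensor I g J x v w z = 0) ↔
      ∀ x (v w : TangentSpace I x), nablaEnd I g J x v w = 0 := by
  refine ⟨fun h x v w ↦ hg.nondegenerate x _ (h x v w), fun h x v w z ↦ ?_⟩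
  rw [structuralTensor, h, map_zero]
  rfl

variable [I.Boundaryless] [FiniteDimensional ℝ E] {g : BilinField I M} {J : EndField I M}

/-! ### Smoothness of the lifted structures -/

theorem isPseudoRiemannianMetric_sasaki (hg : IsPseudoRiemannianMetric I g) :
    IsPseudoRiemannianMetric I.tangent (sasaki I g) where
  symm r ξ η := by
    rw [sasaki_apply, sasaki_apply, hg.symm _ (projDiff I r ξ), hg.symm _ (vertPart I g r ξ)]
  nondegenerate r ξ h := by
    rw [eq_horLift_add_vertLift I g r ξ]
    have h1 : projDiff I r ξ = 0 := hg.nondegenerate _ _ fun w ↦ by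
      have := h (horLift I g r w)
      rwa [sasaki_apply, projDiff_horLift, vertPart_horLift, map_zero, add_zero] at this
    have h2 : vertPart I g r ξ = 0 := hg.nondegenerate _ _ fun w ↦ by
      have := h (vertLift I r w)
      rwa [sasaki_apply, projDiff_vertLift, vertPart_vertLift, map_zero, zero_add] at this
    rw [h1, h2, map_zero, map_zero, add_zero]
  smooth := contMDiff_of_coordBilin I.tangent fun p ↦ by
    rw [extChartAt_tangent_target]
    exact (isMetricOn_coordBilin I hg p.proj).isMetricOn_localSasaki.contDiffOn.congr
      fun q hq ↦ coordBilin_sasaki hg p hq.1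

theorem isAlmostComplex_J₁ (hg : IsPseudoRiemannianMetric I g) :
    IsAlmostComplex I.tangent (J₁ I g) where
  sq := J₁_J₁ g
  smooth := contMDiff_of_coordEnd I.tangent fun p ↦ by
    rw [extChartAt_tangent_target]
    exact ((isMetricOn_coordBilin I hg p.proj).contDiffOn_ofFrame contDiffOn_const).congr
      fun q hq ↦ coordEnd_J₁ hg p hq.1

theorem isAlmostComplex_J₂ (hg : IsPseudoRiemannianMetric I g) (hJ : IsAlmostComplex I J) :
    IsAlmostComplex I.tangent (J₂ I g J) where
  sq r ξ := J₂_J₂ g r ξ hJ.sq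
  smooth := contMDiff_of_coordEnd I.tangent fun p ↦ by
    rw [extChartAt_tangent_target]
    exact ((isMetricOn_coordBilin I hg p.proj).contDiffOn_ofFrame
      (contDiffOn_frameJ₂ (contDiffOn_coordEnd I hJ p.proj))).congr
      fun q hq ↦ coordEnd_J₂ hg J p hq.1

theorem isAlmostComplex_J₃ (hg : IsPseudoRiemannianMetric I g) (hJ : IsAlmostComplex I J) :
    IsAlmostComplex I.tangent (J₃ I g J) where
  sq r ξ := J₃_J₃ g r ξ hJ.sq
  smooth := contMDiff_of_coordEnd I.tangent fun p ↦ by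
    rw [extChartAt_tangent_target]
    exact ((isMetricOn_coordBilin I hg p.proj).contDiffOn_ofFrame
      (contDiffOn_frameJ₃ (contDiffOn_coordEnd I hJ p.proj))).congr
      fun q hq ↦ coordEnd_J₃ hg J p hq.1

/-! ### Covariant derivatives of the lifted structures -/

/-- The covariant derivative for the Sasaki metric at `p`, in terms of the coordinate expressions in
the chart at the base point of `p`. -/
theorem nablaEnd_sasaki (hg : IsPseudoRiemannianMetric I g) (p : TangentBundle I M)
    {J' : EndField I.tangent (TangentBundle I M)} {j : E × E → E × E →L[ℝ] E × E}
    (hj : ∀ q : E × E, q.1 ∈ (extChartAt I p.proj).target →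
      coordEnd I.tangent J' p q = ofFrame (leviCivitaSymbols I g p.proj) j q) (ξ η : E × E) :
    nablaEnd I.tangent (sasaki I g) J' p ξ η =
      localNablaEnd (christoffel (localSasaki (coordBilin I g p.proj)))
        (ofFrame (leviCivitaSymbols I g p.proj) j) ((extChartAt I p.proj p.proj, p.snd) : E × E)
        ξ η := by
  set q₀ : E × E := (extChartAt I p.proj p.proj, p.snd)
  have hmem : {q : E × E | q.1 ∈ (extChartAt I p.proj).target} ∈ 𝓝 q₀ :=
    continuous_fst.continuousAt (extChartAt_target_mem_nhds p.proj)
  have hev : coordEnd I.tangent J' p =ᶠ[𝓝 q₀]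
      ofFrame (leviCivitaSymbols I g p.proj) j := by
    filter_upwards [hmem] with q hq using hj q hq
  have hev' : coordBilin I.tangent (sasaki I g) p =ᶠ[𝓝 q₀]
      localSasaki (coordBilin I g p.proj) := by
    filter_upwards [hmem] with q hq using coordBilin_sasaki hg p hq
  have hself : extChartAt I.tangent p p = q₀ := extChartAt_tangent_self p
  change localNablaEnd (christoffel (coordBilin I.tangent (sasaki I g) p))
    (coordEnd I.tangent J' p) (extChartAt I.tangent p p) ξ η = _
  rw [hself, localNablaEnd, localNablaEnd, christoffel_congr hev',
    hev.fderiv_eq, hev.self_of_nhds]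

theorem nablaEnd_J₁_iff (hg : IsPseudoRiemannianMetric I g) :
    (∀ (p : TangentBundle I M) (ξ η : TangentSpace I.tangent p),
      nablaEnd I.tangent (sasaki I g) (J₁ I g) p ξ η = 0) ↔ IsFlat I g := by
  have key (x : M) := (isMetricOn_coordBilin I hg x).parallel_J₁_iff (mem_extChartAt_target x)
  refine Iff.trans ?_ (forall_congr' key)
  refine ⟨fun h x u ξ η ↦ ?_, fun h p ξ η ↦ ?_⟩
  · exact (nablaEnd_sasaki hg ⟨x, u⟩ (fun q ↦ coordEnd_J₁ hg ⟨x, u⟩) ξ η).symm.trans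
      (h ⟨x, u⟩ ξ η)
  · exact (nablaEnd_sasaki hg p (fun q ↦ coordEnd_J₁ hg p) ξ η).trans (h p.proj p.snd ξ η)

theorem nablaEnd_J₂_iff (hg : IsPseudoRiemannianMetric I g) (hJ : IsAlmostComplex I J) :
    (∀ (p : TangentBundle I M) (ξ η : TangentSpace I.tangent p),
      nablaEnd I.tangent (sasaki I g) (J₂ I g J) p ξ η = 0) ↔
      IsFlat I g ∧ ∀ x (v w : TangentSpace I x), nablaEnd I g J x v w = 0 := by
  have key (x : M) := (isMetricOn_coordBilin I hg x).parallel_J₂_iff (mem_extChartAt_target x)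
    (contDiffOn_coordEnd I hJ x) (coordEnd_sq hJ (mem_extChartAt_target x))
  refine Iff.trans ?_ ((forall_congr' key).trans forall_and)
  refine ⟨fun h x u ξ η ↦ ?_, fun h p ξ η ↦ ?_⟩
  · exact (nablaEnd_sasaki hg ⟨x, u⟩ (fun q ↦ coordEnd_J₂ hg J ⟨x, u⟩) ξ η).symm.trans
      (h ⟨x, u⟩ ξ η)
  · exact (nablaEnd_sasaki hg p (fun q ↦ coordEnd_J₂ hg J p) ξ η).trans (h p.proj p.snd ξ η)

theorem nablaEnd_J₃_iff (hg : IsPseudoRiemannianMetric I g) (hJ : IsAlmostComplex I J) :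
    (∀ (p : TangentBundle I M) (ξ η : TangentSpace I.tangent p),
      nablaEnd I.tangent (sasaki I g) (J₃ I g J) p ξ η = 0) ↔
      IsFlat I g ∧ ∀ x (v w : TangentSpace I x), nablaEnd I g J x v w = 0 := by
  have key (x : M) := (isMetricOn_coordBilin I hg x).parallel_J₃_iff (mem_extChartAt_target x)
    (contDiffOn_coordEnd I hJ x) (coordEnd_sq hJ (mem_extChartAt_target x))
  refine Iff.trans ?_ ((forall_congr' key).trans forall_and)
  refine ⟨fun h x u ξ η ↦ ?_, fun h p ξ η ↦ ?_⟩
  · exact (nablaEnd_sasaki hg ⟨x, u⟩ (fun q ↦ coordEnd_J₃ hg J ⟨x, u⟩) ξ η).symm.trans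
      (h ⟨x, u⟩ ξ η)
  · exact (nablaEnd_sasaki hg p (fun q ↦ coordEnd_J₃ hg J p) ξ η).trans (h p.proj p.snd ξ η)

theorem isAlmostHypercomplexPseudoHermitian_sasaki (hM : IsAlmostSkewHermitian I J g) :
    IsAlmostHypercomplexPseudoHermitian I.tangent (J₁ I g) (J₂ I g J) (J₃ I g J)
      (sasaki I g) where
  metric := isPseudoRiemannianMetric_sasaki hM.metric
  almostComplex₁ := isAlmostComplex_J₁ hM.metric
  almostComplex₂ := isAlmostComplex_J₂ hM.metric hM.almostComplex
  almostComplex₃ := isAlmostComplex_J₃ hM.metric hM.almostComplex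
  comp _ _ := rfl
  anticomm₁₂ := J₁_J₂ g J
  anticomm₂₃ p v := by
    rw [J₃_apply, J₃_apply, J₂_J₁]
  anticomm₃₁ p v := by
    rw [J₃_apply, J₃_apply, J₂_J₁, map_neg]
  compat₁ := sasaki_J₁ g
  compat₂ r ξ η := sasaki_J₂ g r ξ η hM.compat
  compat₃ r ξ η := sasaki_J₃ g r ξ η hM.compat

end Main

end SasakiTangent

open SasakiTangent in
theorem mainTheorem2
    {E : Type*} [NormedAddCommGroup E] [NormedSpace ℝ E] [FiniteDimensional ℝ E]
    {H : Type*} [TopologicalSpace H] (I : ModelWithCorners ℝ E H) [I.Boundaryless]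
    {M : Type*} [TopologicalSpace M] [ChartedSpace H M] [IsManifold I ∞ M]
    (J : EndField I M) (g : BilinField I M) (hM : IsAlmostSkewHermitian I J g) :
    (IsKahler I.tangent (J₁ I g) (sasaki I g) ↔ IsFlat I g) ∧
    (IsSkewKahler I.tangent (J₂ I g J) (sasaki I g) ↔ IsFlat I g ∧ IsSkewKahler I J g) ∧
    (IsSkewKahler I.tangent (J₃ I g J) (sasaki I g) ↔ IsFlat I g ∧ IsSkewKahler I J g) ∧
    (IsPseudoHyperKahler I.tangent (J₁ I g) (J₂ I g J) (J₃ I g J) (sasaki I g) ↔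
      IsFlat I g ∧ IsSkewKahler I J g) := by
  have hH := isAlmostHypercomplexPseudoHermitian_sasaki hM
  have h1 := nablaEnd_J₁_iff hM.metric
  have h2 := nablaEnd_J₂_iff hM.metric hM.almostComplex
  have h3 := nablaEnd_J₃_iff hM.metric hM.almostComplex
  have hF (J') := structuralTensor_eq_zero_iff (I := I.tangent) hH.metric J'
  refine ⟨⟨fun h ↦ ?_, fun h ↦ ?_⟩, ⟨fun h ↦ ?_, fun h ↦ ?_⟩, ⟨fun h ↦ ?_, fun h ↦ ?_⟩,
    ⟨fun h ↦ ?_, fun h ↦ ?_⟩⟩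
  · exact h1.1 ((hF _).1 h.structural_eq_zero)
  · exact ⟨⟨hH.metric, hH.almostComplex₁, hH.compat₁⟩, (hF _).2 (h1.2 h)⟩
  · obtain ⟨hR, hN⟩ := h2.1 h.parallel
    exact ⟨hR, hM, hN⟩
  · exact ⟨⟨hH.metric, hH.almostComplex₂, hH.compat₂⟩, h2.2 ⟨h.1, h.2.parallel⟩⟩
  · obtain ⟨hR, hN⟩ := h3.1 h.parallel
    exact ⟨hR, hM, hN⟩
  · exact ⟨⟨hH.metric, hH.almostComplex₃, hH.compat₃⟩, h3.2 ⟨h.1, h.2.parallel⟩⟩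
  · obtain ⟨hR, hN⟩ := h2.1 ((hF _).1 h.structural₂_eq_zero)
    exact ⟨hR, hM, hN⟩
  · exact ⟨hH, (hF _).2 (h1.2 h.1), (hF _).2 (h2.2 ⟨h.1, h.2.parallel⟩),
      (hF _).2 (h3.2 ⟨h.1, h.2.parallel⟩)⟩
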